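/- Let $H=(V,E)$ be a finite hypergraph, where $E$ may be a multiset, and let $r \ge 2$ and $\Delta \ge 1$ be globally known integers such that every edge has at most $r$ vertices and every vertex lies in at most $\Delta$ edges. The incidence graph $\mathrm{Inc}(H)$ is the bipartite graph on $V \cup E$ in which $v \in V$ and $e \in E$ are adjacent when $v \in e$. A \emph{good coloring} of $H$ is a proper vertex coloring of $\mathrm{Inc}(H)^2$ (distinct nodes at distance at most $2$ in $\mathrm{Inc}(H)$ get distinct colors) with at most $(r\Delta)^d$ colors, where $d$ is a constant. An edge-weighting is a function $a : E \to [0,\infty)$; write $a(L)=\sum_{e\in L} a(e)$ for $L \subseteq E$ and $a(H)=a(E)$. A matching is a set of pairwise disjoint edges. The deterministic LOCAL model on $H$ is the synchronous message-passing model on $\mathrm{Inc}(H)$, with unbounded local computation and unbounded message size, in which every node has a unique identifier and initially knows its identifier, the identifiers of its neighbors, whether it is a vertex or an edge of $H$, its own color and, if it is an edge $e$, the weight $a(e)$. Theorem. There is an absolute constant $c>0$ such that for every constant $d$ the following holds. For every hypergraph $H$ of maximum degree at most $\Delta$ and rank at most $r$, with a good coloring with at most $(r\Delta)^d$ colors and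 an edge-weighting $a$, there is a deterministic LOCAL algorithm (depending only on $r$, $\Delta$ and $d$) that runs in $\tilde O(\log^2 \Delta + r \log \Delta)$ rounds and finds a matching $M$ with $$ a(M) \ \ge\ c\,\frac{a(H)}{r\Delta}. $$ Here $\tilde O(x)$ means at most $C\,x\,\log^m(x+2)$, where $C$ and $m$ depend only on $d$. In particular, the number of rounds depends neither on the number of vertices nor on the weights. -/

import Mathlib

open scoped NNReal

universe u v w

/-- A hypergraph with vertices `V` and hyperedges indexed by `E`. The same vertex set may occur
under several indices, so that the edges form a multiset. -/
structure MultiHypergraph (V : Type u) (E : Type v) where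
  /-- The set of vertices of a hyperedge. -/
  verts : E → Finset V

namespace MultiHypergraph

variable {V : Type u} {E : Type v}

/-- `N(v)`, the set of hyperedges that contain `v`. -/
def star (H : MultiHypergraph V E) (x : V) : Set E := {e | x ∈ H.verts e}

/-- `Δ` is an upper bound on the degrees. -/
def DegreeLE (H : MultiHypergraph V E) (Δ : ℕ) : Prop :=
  ∀ x, (H.star x).Finite ∧ (H.star x).ncard ≤ Δ

/-- `r` is an upper bound on the sizes of the hyperedges. -/
def RankLE (H : MultiHypergraph V E) (r : ℕ) : Prop := ∀ e, (H.verts e).card ≤ r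

/-- A matching is a set of pairwise disjoint hyperedges (two copies of a nonempty hyperedge are
not disjoint). -/
def IsMatching (H : MultiHypergraph V E) (M : Finset E) : Prop :=
  (M : Set E).PairwiseDisjoint H.verts

/-- The incidence graph: bipartite on `V ⊕ E`, with `x` and `e` adjacent when `x ∈ e`. -/
def incGraph (H : MultiHypergraph V E) : SimpleGraph (V ⊕ E) :=
  SimpleGraph.fromRel fun p q => ∃ x e, p = Sum.inl x ∧ q = Sum.inr e ∧ x ∈ H.verts e

end MultiHypergraph

/-- The power graph `G ^ t`: distinct nodes at distance at most `t` are joined. -/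
def powerGraph {W : Type w} (G : SimpleGraph W) (t : ℕ) : SimpleGraph W where
  Adj p q := p ≠ q ∧ ∃ walk : G.Walk p q, walk.length ≤ t
  symm := ⟨fun _ _ h => ⟨h.1.symm, h.2.choose.reverse, by
    rw [SimpleGraph.Walk.length_reverse]; exact h.2.choose_spec⟩⟩
  loopless := ⟨fun _ h => h.1 rfl⟩

/-- A deterministic algorithm in the LOCAL model, for local inputs `I` and local outputs `O`.
Local computation and message size are unrestricted. Nodes are identified by distinct natural
numbers. -/
structure LocalAlgorithm (I O : Type) where
  /-- The states of a node. -/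
  State : Type
  /-- The messages. -/
  Msg : Type
  /-- The initial state, from the node's own identifier, its local input, and the set of
  identifiers of its neighbors. -/
  init : ℕ → I → Set ℕ → State
  /-- The message that a node in the given state sends to the neighbor with the given
  identifier. -/
  send : State → ℕ → Msg
  /-- The new state, from the old one and the set of pairs
  (identifier of the sender, message received). -/
  step : State → Set (ℕ × Msg) → State
  /-- The output that a node reads off its state when the execution ends. -/
  out : State → O

namespace LocalAlgorithm

variable {I O : Type} {W : Type w}

/-- The states of all nodes after a number of synchronous rounds of communication along the edges
of `G`. -/
def stateAfter (A : LocalAlgorithm I O) (G : SimpleGraph W) (ident : W ↪ ℕ) (input : W → I) :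
    ℕ → W → A.State
  | 0, p => A.init (ident p) (input p) {j | ∃ q, G.Adj p q ∧ j = ident q}
  | t + 1, p => A.step (A.stateAfter G ident input t p)
      {m | ∃ q, G.Adj p q ∧ m = (ident q, A.send (A.stateAfter G ident input t q) (ident p))}

/-- The outputs of all nodes when the algorithm is stopped after `T` rounds. -/
def outputAfter (A : LocalAlgorithm I O) (G : SimpleGraph W) (ident : W ↪ ℕ) (input : W → I)
    (T : ℕ) (p : W) : O :=
  A.out (A.stateAfter G ident input T p)

end LocalAlgorithm

/-- What a node of the incidence graph of a weighted, colored hypergraph knows at the start (besides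
the identifiers): whether it is a vertex or a hyperedge, its weight if it is a hyperedge, and its own
color. -/
structure NodeInput (k : ℕ) where
  /-- `none` for a vertex, `some (a e)` for a hyperedge `e`. -/
  weight : Option ℝ≥0
  /-- The color of the node. -/
  color : Fin k

namespace MultiHypergraph

variable {V : Type u} {E : Type v}

/-- A good coloring with parameters `r`, `Δ`: a proper coloring of the square of the incidence graph
with polynomially many colors. For `2 ≤ r` and `1 ≤ Δ`, every polynomial in `r` and `Δ` is at most
`(r * Δ) ^ d` for some constant `d`; the exponent `d` is a parameter. -/
abbrev GoodColoring (H : MultiHypergraph V E) (r Δ d : ℕ) :=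
  (powerGraph H.incGraph 2).Coloring (Fin ((r * Δ) ^ d))

/-- The local inputs given by an edge-weighting and a coloring. -/
def nodeInput {k : ℕ} (a : E → ℝ≥0) (χ : V ⊕ E → Fin k) : V ⊕ E → NodeInput k
  | Sum.inl x => ⟨none, χ (Sum.inl x)⟩
  | Sum.inr e => ⟨some (a e), χ (Sum.inr e)⟩

/-- The set of hyperedges that output `true` when `A` is run for `T` rounds on the incidence graph
of `H`. -/
def selectedEdges [Fintype E] (H : MultiHypergraph V E) {k : ℕ}
    (A : LocalAlgorithm (NodeInput k) Bool) (T : ℕ) (ident : V ⊕ E ↪ ℕ) (a : E → ℝ≥0)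
    (χ : V ⊕ E → Fin k) : Finset E :=
  Finset.univ.filter fun e =>
    A.outputAfter H.incGraph ident (nodeInput a χ) T (Sum.inr e) = true

end MultiHypergraph

/-- `IsSoftO D f g`: on the domain `D` we have `f = Õ(g)`, that is, `f ≤ g * polylog g`. -/
def IsSoftO {ι : Type w} (D : Set ι) (f g : ι → ℝ) : Prop :=
  ∃ (C : ℝ) (m : ℕ), ∀ i ∈ D, f i ≤ C * (g i * Real.log (g i + 2) ^ m)

/-! Give every hyperedge the value `2 ^ (-K)`, where `2 ^ K` lies between `4 * (r * Δ)` and `8 * (r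
* Δ)`, and round in `K` steps: in each step a hyperedge that is still present either doubles its
value or drops to `0`. The potential is the weight minus a multiple of the cost, where the cost
sums, over ordered pairs of distinct meeting hyperedges, the smaller weight times both values. At
the start, twice the cost is at most half the weight. At the end the values are `0` or `1`, and
deleting every hyperedge that meets a heavier selected one leaves a matching of weight at least
weight minus cost (`exists_isLocal_matching`).

A rounding step treats the classes of a coloring one after another. If conflicts inside classes are
ignored, the potential is affine in the values of each class, so the sign of the partial derivative
tells which way to round (`quadratic_rounding`). A proper coloring with few colors is not available
quickly, but a defective one is: with `B ^ 2` classes, the monochromatic share of the cost is at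
most `4 / B ^ 2` (`exists_isLocal_classes`). It comes from the given coloring by Reed–Solomon
recoloring (`monoWeight_recolor`) and a greedy sweep (`monoWeight_greedy`). Since `B ^ 2 ≥ 32 * K`,
the total loss over `K` steps only lowers the multiple of the cost from `2` to `1`.

With `B ^ 2` of order `K`, a step takes `K` exchanges up to factors polylogarithmic in `K`, so the
total is about `K ^ 2`, that is, the square of `log (r * Δ)`. As the square of `log r` is `O(r)`, it
is absorbed by `r * log Δ` once `Δ ≥ 2`; for `Δ = 1` all hyperedges are disjoint and no
communication is needed.

All of this is phrased for quantities that depend only on the `view` of a hyperedge;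
`IsLocal.exists_algorithm` turns them into message passing, with two rounds per exchange. -/

/-! ### Views and local quantities -/

/-- A hypergraph together with the identifiers, weights and colors that its nodes know. -/
structure LocalInstance (k : ℕ) where
  /-- The vertices. -/
  V : Type u
  /-- The hyperedges. -/
  E : Type v
  /-- There are finitely many hyperedges. -/
  fintypeE : Fintype E
  /-- The hypergraph. -/
  H : MultiHypergraph V E
  /-- The identifiers. -/
  ident : V ⊕ E ↪ ℕ
  /-- The edge-weighting. -/
  a : E → ℝ≥0
  /-- The colors. -/
  χ : V ⊕ E → Fin k

namespace LocalInstance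

variable {k : ℕ}

instance (I : LocalInstance.{u, v} k) : Fintype I.E := I.fintypeE

/-- Two hyperedges meet if they have a common vertex. -/
def Meets (I : LocalInstance.{u, v} k) (e f : I.E) : Prop :=
  ∃ x, x ∈ I.H.verts e ∧ x ∈ I.H.verts f

lemma Meets.symm {I : LocalInstance.{u, v} k} {e f : I.E} (h : I.Meets e f) : I.Meets f e :=
  let ⟨x, hx⟩ := h; ⟨x, hx.2, hx.1⟩

lemma meets_comm {I : LocalInstance.{u, v} k} {e f : I.E} : I.Meets e f ↔ I.Meets f e :=
  ⟨Meets.symm, Meets.symm⟩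

/-- What a hyperedge can learn about its surroundings in a number of exchanges with the hyperedges
that it meets. -/
def View (k : ℕ) : ℕ → Type
  | 0 => ℕ × ℝ≥0 × Fin k
  | j + 1 => View k j × Set (View k j)

/-- The view of a hyperedge. -/
def view (I : LocalInstance.{u, v} k) : (j : ℕ) → I.E → View k j
  | 0, e => (I.ident (Sum.inr e), I.a e, I.χ (Sum.inr e))
  | j + 1, e => (I.view j e, {w | ∃ f, I.Meets e f ∧ w = I.view j f})

/-- A quantity on the hyperedges is `j`-local if it is a function of the view after `j`
exchanges. -/
def IsLocal (j : ℕ) {O : Type*} (φ : ∀ I : LocalInstance.{u, v} k, I.E → O) : Prop :=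
  ∃ g : View k j → O, ∀ I e, φ I e = g (I.view j e)

/-- A quantity on the pairs of hyperedges is `j`-local if it vanishes on pairs that do not meet, and
otherwise is a function of the two views after `j` exchanges. -/
def IsLocalPair (j : ℕ) {R : Type*} [Zero R]
    (W : ∀ I : LocalInstance.{u, v} k, I.E → I.E → R) : Prop :=
  ∃ κ : View k j → View k j → R, (∀ I e f, I.Meets e f → W I e f = κ (I.view j e) (I.view j f)) ∧
    ∀ I e f, ¬ I.Meets e f → W I e f = 0

section Closure

variable {j : ℕ} {O P : Type*}

lemma IsLocal.succ {φ : ∀ I : LocalInstance.{u, v} k, I.E → O} (h : IsLocal j φ) :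
    IsLocal (j + 1) φ := by
  obtain ⟨g, hg⟩ := h
  exact ⟨fun w => g w.1, hg⟩

lemma IsLocal.mono {φ : ∀ I : LocalInstance.{u, v} k, I.E → O} (h : IsLocal j φ) {i : ℕ}
    (hi : j ≤ i) : IsLocal i φ := by
  induction hi with
  | refl => exact h
  | step _ ih => exact ih.succ

lemma IsLocal.comp {φ : ∀ I : LocalInstance.{u, v} k, I.E → O} (h : IsLocal j φ) (F : O → P) :
    IsLocal j fun I e => F (φ I e) := by
  obtain ⟨g, hg⟩ := h
  exact ⟨fun w => F (g w), fun I e => by simp only [hg]⟩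

lemma IsLocal.pair {φ : ∀ I : LocalInstance.{u, v} k, I.E → O}
    {ψ : ∀ I : LocalInstance.{u, v} k, I.E → P} (h : IsLocal j φ) (h' : IsLocal j ψ) :
    IsLocal j fun I e => (φ I e, ψ I e) := by
  obtain ⟨g, hg⟩ := h
  obtain ⟨g', hg'⟩ := h'
  exact ⟨fun w => (g w, g' w), fun I e => by simp only [hg, hg']⟩

lemma IsLocal.comp₂ {Q : Type*} {φ : ∀ I : LocalInstance.{u, v} k, I.E → O}
    {ψ : ∀ I : LocalInstance.{u, v} k, I.E → P} (h : IsLocal j φ) (h' : IsLocal j ψ)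
    (F : O → P → Q) : IsLocal j fun I e => F (φ I e) (ψ I e) :=
  (h.pair h').comp fun p => F p.1 p.2

lemma isLocal_const (c : O) : IsLocal j fun (I : LocalInstance.{u, v} k) (_ : I.E) => c :=
  ⟨fun _ => c, fun _ _ => rfl⟩

lemma isLocal_ident :
    IsLocal 0 fun (I : LocalInstance.{u, v} k) (e : I.E) => I.ident (Sum.inr e) :=
  ⟨fun w => w.1, fun _ _ => rfl⟩

lemma isLocal_weight : IsLocal 0 fun (I : LocalInstance.{u, v} k) (e : I.E) => I.a e :=
  ⟨fun w => w.2.1, fun _ _ => rfl⟩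

lemma isLocal_color : IsLocal 0 fun (I : LocalInstance.{u, v} k) (e : I.E) => I.χ (Sum.inr e) :=
  ⟨fun w => w.2.2, fun _ _ => rfl⟩

/-- Views contain identifiers, so a set of views received from the surroundings loses no
multiplicities. -/
lemma view_injective (I : LocalInstance.{u, v} k) (j : ℕ) : Function.Injective (I.view j) := by
  intro e f hef
  obtain ⟨g, hg⟩ := (isLocal_ident.{u, v} (k := k)).mono (Nat.zero_le j)
  have h : I.ident (Sum.inr e) = I.ident (Sum.inr f) :=
    (hg I e).trans ((congrArg g hef).trans (hg I f).symm)
  exact Sum.inr_injective (I.ident.injective h)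

variable {R R' : Type*}

lemma IsLocalPair.map [Zero R] [Zero R'] {W : ∀ I : LocalInstance.{u, v} k, I.E → I.E → R}
    {φ : ∀ I : LocalInstance.{u, v} k, I.E → O} (hW : IsLocalPair j W) (hφ : IsLocal j φ)
    (F : O → O → R → R') (hF : ∀ p q, F p q 0 = 0) :
    IsLocalPair j fun I e f => F (φ I e) (φ I f) (W I e f) := by
  obtain ⟨κ, hκ, hκ'⟩ := hW
  obtain ⟨g, hg⟩ := hφ
  refine ⟨fun w w' => F (g w) (g w') (κ w w'), fun I e f h => ?_, fun I e f h => ?_⟩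
  · simp only [hg, hκ I e f h]
  · simp only [hκ' I e f h, hF]

lemma IsLocalPair.mono [Zero R] {W : ∀ I : LocalInstance.{u, v} k, I.E → I.E → R}
    (hW : IsLocalPair j W) {i : ℕ} (hi : j ≤ i) : IsLocalPair i W := by
  induction hi with
  | refl => exact hW
  | step _ ih =>
    obtain ⟨κ, hκ, hκ'⟩ := ih
    exact ⟨fun w w' => κ w.1 w'.1, hκ, hκ'⟩

open scoped Classical in
lemma isLocalPair_meets [Zero R] (c : R) :
    IsLocalPair j fun (I : LocalInstance.{u, v} k) e f => if I.Meets e f then c else 0 :=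
  ⟨fun _ _ => c, fun _ _ _ h => if_pos h, fun _ _ _ h => if_neg h⟩

/-- One more exchange delivers the views of all hyperedges that meet `e`, and the others contribute
`0`. Distinct hyperedges have distinct views, so summing over the set of views is summing over
hyperedges. -/
lemma IsLocalPair.sum [AddCommMonoid R] {W : ∀ I : LocalInstance.{u, v} k, I.E → I.E → R}
    (hW : IsLocalPair j W) : IsLocal (j + 1) fun I e => ∑ f, W I e f := by
  classical
  obtain ⟨κ, hκ, hκ'⟩ := hW
  refine ⟨fun w => ∑ᶠ w' ∈ w.2, κ w.1 w', fun I e => ?_⟩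
  have himage : (I.view (j + 1) e).2
      = ((Finset.univ.filter fun f => I.Meets e f).image (I.view j) : Finset (View k j)) := by
    ext w
    simp only [view, Set.mem_ofPred_eq, Finset.coe_image, Finset.coe_filter, Finset.mem_univ,
      true_and, Set.mem_image]
    exact ⟨fun ⟨f, h, h'⟩ => ⟨f, h, h'.symm⟩, fun ⟨f, h, h'⟩ => ⟨f, h, h'.symm⟩⟩
  dsimp only
  rw [himage, finsum_mem_coe_finset, Finset.sum_image ((I.view_injective j).injOn),
    Finset.sum_filter]
  refine Finset.sum_congr rfl fun f _ => ?_
  split_ifs with h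
  · exact hκ I e f h
  · exact hκ' I e f h

end Closure

/-! ### Collecting views by message passing -/

section Simulation

/-- The state of a node in the algorithm that collects views: hyperedges keep their view, and
vertices keep the views of their hyperedges. -/
structure Collector (k : ℕ) where
  /-- The number of rounds so far. -/
  clock : ℕ
  /-- The view, for a hyperedge. -/
  own : Option (Σ j, View k j)
  /-- The views received in the last round. -/
  seen : Set (Σ j, View k j)

/-- A view extended by the views in a given set. -/
def extendView (X : Set (Σ j, View k j)) (w : Σ j, View k j) : Σ j, View k j :=
  ⟨w.1 + 1, (w.2, {w' | ⟨w.1, w'⟩ ∈ X})⟩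

open scoped Classical in
/-- The algorithm that collects views, and outputs a function of them. -/
noncomputable def collect (J : ℕ) (g : View k J → Bool) :
    LocalAlgorithm (NodeInput k) Bool where
  State := Collector k
  Msg := Set (Σ j, View k j)
  init i inp _ := ⟨0, inp.weight.map fun a => ⟨0, (i, a, inp.color)⟩, ∅⟩
  send s _ := s.own.elim s.seen fun w => {w}
  step s X :=
    ⟨s.clock + 1,
      if s.clock % 2 = 1 then s.own.map (extendView {w | ∃ m ∈ X, w ∈ m.2}) else s.own,
      {w | ∃ m ∈ X, w ∈ m.2}⟩
  out s := s.own.elim false fun w => if h : w.1 = J then g (h ▸ w.2) else false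

variable (I : LocalInstance.{u, v} k) (J : ℕ) (g : View k J → Bool)

lemma adj_inl_inr {x : I.V} {e : I.E} :
    I.H.incGraph.Adj (Sum.inl x) (Sum.inr e) ↔ x ∈ I.H.verts e := by
  simp [MultiHypergraph.incGraph, SimpleGraph.fromRel_adj]

lemma adj_inr_inl {x : I.V} {e : I.E} :
    I.H.incGraph.Adj (Sum.inr e) (Sum.inl x) ↔ x ∈ I.H.verts e := by
  rw [SimpleGraph.adj_comm, adj_inl_inr]

lemma not_adj_inl_inl {x y : I.V} : ¬ I.H.incGraph.Adj (Sum.inl x) (Sum.inl y) := by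
  simp [MultiHypergraph.incGraph, SimpleGraph.fromRel_adj]

lemma not_adj_inr_inr {e f : I.E} : ¬ I.H.incGraph.Adj (Sum.inr e) (Sum.inr f) := by
  simp [MultiHypergraph.incGraph, SimpleGraph.fromRel_adj]

/-- The states of the nodes when views are collected. -/
noncomputable def collectState (t : ℕ) : I.V ⊕ I.E → Collector k :=
  (collect J g).stateAfter I.H.incGraph I.ident (MultiHypergraph.nodeInput I.a I.χ) t

lemma collectState_clock (t : ℕ) (p : I.V ⊕ I.E) : (I.collectState J g t p).clock = t := by
  induction t generalizing p with
  | zero => rfl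
  | succ t ih => exact congrArg (· + 1) (ih p)

lemma collectState_own_succ (t : ℕ) (p : I.V ⊕ I.E) :
    (I.collectState J g (t + 1) p).own = if t % 2 = 1 then
      (I.collectState J g t p).own.map (extendView (I.collectState J g (t + 1) p).seen)
      else (I.collectState J g t p).own := by
  have h : (I.collectState J g (t + 1) p).own = if (I.collectState J g t p).clock % 2 = 1 then
      (I.collectState J g t p).own.map (extendView (I.collectState J g (t + 1) p).seen)
      else (I.collectState J g t p).own := rfl
  rw [h, collectState_clock]

lemma mem_collectState_seen_succ (t : ℕ) (p : I.V ⊕ I.E) (w : Σ j, View k j) :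
    w ∈ (I.collectState J g (t + 1) p).seen ↔ ∃ q, I.H.incGraph.Adj p q ∧
      w ∈ (I.collectState J g t q).own.elim (I.collectState J g t q).seen fun w => {w} := by
  constructor
  · rintro ⟨_, ⟨q, hq, rfl⟩, hw⟩
    exact ⟨q, hq, hw⟩
  · rintro ⟨q, hq, hw⟩
    exact ⟨_, ⟨q, hq, rfl⟩, hw⟩

lemma collectState_own_inl (t : ℕ) (x : I.V) : (I.collectState J g t (Sum.inl x)).own = none := by
  induction t with
  | zero => rfl
  | succ t ih => rw [collectState_own_succ, ih]; simp

/-- Vertices act as relays: in one round they gather the views of their hyperedges, in the next they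
pass them on. Hence hyperedges extend their views only in every second round. -/
lemma collectState_own_inr (j : ℕ) (e : I.E) :
    (I.collectState J g (2 * j) (Sum.inr e)).own = some ⟨j, I.view j e⟩ := by
  induction j generalizing e with
  | zero => rfl
  | succ j ih =>
    have hodd : ∀ e, (I.collectState J g (2 * j + 1) (Sum.inr e)).own = some ⟨j, I.view j e⟩ := by
      intro e
      rw [collectState_own_succ, if_neg (by omega), ih]
    have hseen : ∀ x w, w ∈ (I.collectState J g (2 * j + 1) (Sum.inl x)).seen ↔
        ∃ f, x ∈ I.H.verts f ∧ w = ⟨j, I.view j f⟩ := by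
      intro x w
      rw [mem_collectState_seen_succ]
      constructor
      · rintro ⟨y | f, hq, hw⟩
        · exact absurd hq I.not_adj_inl_inl
        · rw [ih] at hw
          exact ⟨f, I.adj_inl_inr.1 hq, hw⟩
      · rintro ⟨f, hf, hw⟩
        refine ⟨Sum.inr f, I.adj_inl_inr.2 hf, ?_⟩
        rw [ih]
        exact hw
    rw [show 2 * (j + 1) = 2 * j + 1 + 1 by ring, collectState_own_succ, if_pos (by omega), hodd,
      Option.map_some, extendView]
    simp only [view]
    congr 3
    ext w
    simp only [Set.mem_ofPred_eq]
    rw [mem_collectState_seen_succ]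
    constructor
    · rintro ⟨x | f, hq, hw⟩
      · rw [collectState_own_inl] at hw
        obtain ⟨f, hf, hw⟩ := (hseen x _).1 hw
        refine ⟨f, ⟨x, I.adj_inr_inl.1 hq, hf⟩, ?_⟩
        simpa using hw
      · exact absurd hq I.not_adj_inr_inr
    · rintro ⟨f, ⟨x, hx, hf⟩, rfl⟩
      refine ⟨Sum.inl x, I.adj_inr_inl.2 hx, ?_⟩
      rw [collectState_own_inl]
      exact (hseen x _).2 ⟨f, hf, rfl⟩

/-- Local sets of hyperedges can be computed in the LOCAL model. -/
lemma IsLocal.exists_algorithm {j : ℕ} {φ : ∀ I : LocalInstance.{u, v} k, I.E → Bool}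
    (h : IsLocal j φ) : ∃ A : LocalAlgorithm (NodeInput k) Bool,
      ∀ I : LocalInstance.{u, v} k, I.H.selectedEdges A (2 * j) I.ident I.a I.χ
        = Finset.univ.filter fun e => φ I e = true := by
  obtain ⟨g, hg⟩ := h
  refine ⟨collect j g, fun I => ?_⟩
  refine Finset.filter_congr fun e _ => ?_
  have hout : (collect j g).outputAfter I.H.incGraph I.ident
      (MultiHypergraph.nodeInput I.a I.χ) (2 * j) (Sum.inr e)
      = (I.collectState j g (2 * j) (Sum.inr e)).own.elim false
        fun w => if h : w.1 = j then g (h ▸ w.2) else false := rfl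
  rw [hout, collectState_own_inr, hg]
  simp

end Simulation

end LocalInstance

/-! ### Averaging and codes -/

section Minimum

variable {ι : Type*} [Finite ι] [Nonempty ι]

/-- A point where a real function on a finite type is minimal. -/
noncomputable def argMin (f : ι → ℝ) : ι := (Finite.exists_min f).choose

lemma apply_argMin_le (f : ι → ℝ) (i : ι) : f (argMin f) ≤ f i :=
  (Finite.exists_min f).choose_spec i

end Minimum

lemma card_mul_le_sum {ι : Type*} [Fintype ι] {f : ι → ℝ} {x : ℝ} (h : ∀ i, x ≤ f i) :
    (Fintype.card ι : ℝ) * x ≤ ∑ i, f i := by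
  have := Finset.card_nsmul_le_sum Finset.univ f x fun i _ => h i
  simpa using this

/-- Reed–Solomon codes: distinct messages have code words that agree in few places. -/
lemma exists_code {q D N : ℕ} [Fact q.Prime] (h : N ≤ q ^ D) :
    ∃ code : ℕ → ZMod q → ZMod q, ∀ c < N, ∀ c' < N, c ≠ c' →
      (Finset.univ.filter fun x => code c x = code c' x).card ≤ D := by
  classical
  have hcard : Fintype.card (Fin N) ≤ Fintype.card (Fin D → ZMod q) := by simpa using h
  obtain ⟨φ⟩ := Function.Embedding.nonempty_of_card_le hcard
  let P : Fin N → Polynomial (ZMod q) := fun c => (Polynomial.degreeLTEquiv (ZMod q) D).symm (φ c)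
  have hP : Function.Injective P := fun c c' hcc =>
    φ.injective ((Polynomial.degreeLTEquiv (ZMod q) D).symm.injective (Subtype.ext hcc))
  refine ⟨fun c x => if hc : c < N then (P ⟨c, hc⟩).eval x else 0, fun c hc c' hc' hne => ?_⟩
  have hsub : P ⟨c, hc⟩ - P ⟨c', hc'⟩ ≠ 0 := by
    rw [sub_ne_zero]
    exact fun h => hne (congrArg Fin.val (hP h))
  have hmem : P ⟨c, hc⟩ - P ⟨c', hc'⟩ ∈ Polynomial.degreeLT (ZMod q) D :=
    Submodule.sub_mem _ (Subtype.property _) (Subtype.property _)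
  have hdeg : (P ⟨c, hc⟩ - P ⟨c', hc'⟩).natDegree < D :=
    (Polynomial.natDegree_lt_iff_degree_lt hsub).2 (Polynomial.mem_degreeLT.1 hmem)
  refine le_trans ?_ hdeg.le
  refine Polynomial.card_le_degree_of_subset_roots fun x hx => ?_
  simp only [Finset.filter_val, Multiset.mem_filter, Finset.mem_val, Finset.mem_univ, true_and,
    dif_pos hc, dif_pos hc'] at hx
  rw [Polynomial.mem_roots hsub, Polynomial.IsRoot, Polynomial.eval_sub, hx, sub_self]

/-! ### Defective colorings and rounding, without locality -/

section MonoWeight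

open scoped Classical

variable {E : Type v} [Fintype E] {O P : Type*}

/-- The weight of the monochromatic pairs, for a coloring `c` and weights `W` on the ordered
pairs. -/
noncomputable def monoWeight (W : E → E → ℝ) (c : E → O) : ℝ :=
  ∑ e, ∑ f, if c e = c f then W e f else 0

variable {W : E → E → ℝ}

lemma monoWeight_comp_injective (c : E → O) {i : O → P} (hi : Function.Injective i) :
    monoWeight W (fun e => i (c e)) = monoWeight W c := by
  simp only [monoWeight, hi.eq_iff]

lemma monoWeight_pair (c : E → O) (c' : E → P) :
    monoWeight W (fun e => (c e, c' e))
      = monoWeight (fun e f => if c e = c f then W e f else 0) c' := by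
  refine Finset.sum_congr rfl fun e _ => Finset.sum_congr rfl fun f _ => ?_
  by_cases h : c e = c f <;> by_cases h' : c' e = c' f <;> simp [h, h']

/-- Each node picks the position at which its code word agrees with the fewest words of other
colors, by weight. Two distinct words agree in at most `D` of `q` positions, so the best position is
at most the average, `D / q` of the row. A new conflict needs equal positions, so it is already
counted by the choice of `e` alone, and all nodes can choose at once. -/
lemma monoWeight_recolor (hW : ∀ e f, 0 ≤ W e f) {q D N : ℕ} [Fact q.Prime] {c : E → ℕ}
    (hc : ∀ e, c e < N) {code : ℕ → ZMod q → ZMod q}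
    (hcode : ∀ c < N, ∀ c' < N, c ≠ c' →
      (Finset.univ.filter fun x => code c x = code c' x).card ≤ D) {x : E → ZMod q}
    (hx : ∀ e y, (∑ f, if c e ≠ c f ∧ code (c e) (x e) = code (c f) (x e) then W e f else 0)
      ≤ ∑ f, if c e ≠ c f ∧ code (c e) y = code (c f) y then W e f else 0) :
    monoWeight W (fun e => (x e, code (c e) (x e)))
      ≤ monoWeight W c + D / q * ∑ e, ∑ f, W e f := by
  have hq : (0 : ℝ) < q := by exact_mod_cast (Fact.out : q.Prime).pos
  have hrow : ∀ e, (∑ f, if c e ≠ c f ∧ code (c e) (x e) = code (c f) (x e) then W e f else 0)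
      ≤ D / q * ∑ f, W e f := by
    intro e
    rw [div_mul_eq_mul_div, le_div_iff₀' hq]
    have h := card_mul_le_sum (hx e)
    rw [ZMod.card] at h
    refine h.trans ?_
    rw [Finset.sum_comm, Finset.mul_sum]
    refine Finset.sum_le_sum fun f _ => ?_
    by_cases hef : c e = c f
    · simpa [hef] using mul_nonneg (Nat.cast_nonneg D) (hW e f)
    · simp only [ne_eq, hef, not_false_eq_true, true_and]
      rw [← Finset.sum_filter, Finset.sum_const, nsmul_eq_mul]
      refine mul_le_mul_of_nonneg_right ?_ (hW e f)
      exact_mod_cast hcode _ (hc e) _ (hc f) hef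
  unfold monoWeight
  rw [Finset.mul_sum, ← Finset.sum_add_distrib]
  refine Finset.sum_le_sum fun e _ => ?_
  refine le_trans ?_ (add_le_add le_rfl (hrow e))
  rw [← Finset.sum_add_distrib]
  refine Finset.sum_le_sum fun f _ => ?_
  by_cases h : c e = c f
  · simp only [Prod.mk.injEq, h, if_true, ne_eq, not_true, false_and, if_false, add_zero]
    split_ifs
    exacts [le_rfl, hW e f]
  · simp only [Prod.mk.injEq, h, if_false, ne_eq, not_false_eq_true, true_and, zero_add]
    split_ifs with h₁ h₂ h₂
    · exact le_rfl
    · exact absurd (by rw [h₁.2, h₁.1]) h₂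
    · exact hW e f
    · exact le_rfl

/-- Every node takes the color that carries the least weight among its neighbors of smaller old
color, at most a `1 / B` share. A pair with different old colors is charged to its later end;
symmetry of `W` accounts for the opposite order. -/
lemma monoWeight_greedy (hW : ∀ e f, 0 ≤ W e f) (hsymm : ∀ e f, W e f = W f e) {B : ℕ}
    (hB : 0 < B) {c : E → ℕ} {g : E → Fin B}
    (hg : ∀ e b, (∑ f, if c f < c e ∧ g f = g e then W e f else 0)
      ≤ ∑ f, if c f < c e ∧ g f = b then W e f else 0) :
    monoWeight W g ≤ monoWeight W c + 1 / B * ∑ e, ∑ f, W e f := by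
  have hB' : (0 : ℝ) < B := by exact_mod_cast hB
  have hrow : ∀ e, (∑ f, if c f < c e ∧ g f = g e then W e f else 0)
      ≤ 1 / B * ∑ f, if c f < c e then W e f else 0 := by
    intro e
    rw [one_div_mul_eq_div, le_div_iff₀' hB']
    have h := card_mul_le_sum (hg e)
    rw [Fintype.card_fin] at h
    refine h.trans_eq ?_
    rw [Finset.sum_comm]
    refine Finset.sum_congr rfl fun f _ => ?_
    by_cases hef : c f < c e <;> simp [hef]
  have hswap : (∑ e, ∑ f, if c e < c f ∧ g f = g e then W e f else 0)
      = ∑ e, ∑ f, if c f < c e ∧ g f = g e then W e f else 0 := by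
    rw [Finset.sum_comm]
    refine Finset.sum_congr rfl fun e _ => Finset.sum_congr rfl fun f _ => ?_
    simp only [hsymm f e, eq_comm (a := g e)]
  have hswap' : (∑ e, ∑ f, if c e < c f then W e f else 0)
      = ∑ e, ∑ f, if c f < c e then W e f else 0 := by
    rw [Finset.sum_comm]
    refine Finset.sum_congr rfl fun e _ => Finset.sum_congr rfl fun f _ => ?_
    rw [hsymm f e]
  have hmono : monoWeight W g ≤ monoWeight W c
      + (∑ e, ∑ f, if c f < c e ∧ g f = g e then W e f else 0)
      + ∑ e, ∑ f, if c e < c f ∧ g f = g e then W e f else 0 := by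
    unfold monoWeight
    simp only [← Finset.sum_add_distrib]
    refine Finset.sum_le_sum fun e _ => Finset.sum_le_sum fun f _ => ?_
    have := hW e f
    by_cases h : g e = g f
    · rcases lt_trichotomy (c e) (c f) with h' | h' | h'
      · simp [h, h', h'.ne, h'.not_gt]
      · simp [h, h']
      · simp [h, h', h'.ne', h'.not_gt]
    · have h' : ¬ g f = g e := fun h' => h h'.symm
      simp only [h, h', if_false, and_false, add_zero]
      split_ifs <;> simp [this]
  have htotal : (∑ e, ∑ f, if c f < c e then W e f else 0)
      + (∑ e, ∑ f, if c e < c f then W e f else 0) ≤ ∑ e, ∑ f, W e f := by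
    simp only [← Finset.sum_add_distrib]
    refine Finset.sum_le_sum fun e _ => Finset.sum_le_sum fun f _ => ?_
    have := hW e f
    rcases lt_trichotomy (c e) (c f) with h' | h' | h'
    · simp [h', h'.not_gt]
    · simp [h', this]
    · simp [h', h'.not_gt]
  have hsum : (∑ e, ∑ f, if c f < c e ∧ g f = g e then W e f else 0)
      ≤ 1 / B * ∑ e, ∑ f, if c f < c e then W e f else 0 := by
    rw [Finset.mul_sum]
    exact Finset.sum_le_sum fun e _ => hrow e
  rw [hswap] at hmono
  rw [hswap'] at htotal
  have := mul_le_mul_of_nonneg_left htotal (one_div_nonneg.2 hB'.le)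
  linarith

/-- Rounding a half-integral point to an integral one, one color class after another, by the sign of
the partial derivatives of a quadratic form. -/
lemma quadratic_rounding {w : E → E → ℝ} (hw : ∀ e f, 0 ≤ w e f)
    (hsymm : ∀ e f, w e f = w f e) {a s z : E → ℝ} (hs : ∀ e, s e = 0 ∨ s e = 1)
    (hz : ∀ e, z e = 0 ∨ z e = 1) (hzs : ∀ e, s e = 0 → z e = 0) {θ : ℝ} (hθ : 0 ≤ θ) {c : E → ℕ}
    (hstep : ∀ e, 0 ≤ (2 * z e - s e) * (a e - 2 * θ * ∑ f,
      (if c e = c f then 0 else w e f * s e * s f) * if c f < c e then 2 * z f else s f)) :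
    ∑ e, a e * s e - θ * ∑ e, ∑ f, w e f * s e * s f
        - 4 * θ * monoWeight (fun e f => w e f * s e * s f) c
      ≤ 2 * ∑ e, a e * z e - 4 * θ * ∑ e, ∑ f, w e f * z e * z f := by
  -- Without monochromatic pairs, nodes that move simultaneously do not interact. `hquad` puts these
  -- pairs back.
  set W : E → E → ℝ := fun e f => if c e = c f then 0 else w e f * s e * s f with hWdef
  have hWsymm : ∀ e f, W e f = W f e := by
    intro e f
    simp only [hWdef, eq_comm (a := c e), hsymm e f]
    split_ifs <;> ring
  -- The interaction with `f` when `e` moves from `s e` to `2 * z e`: `f` has already moved exactly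
  -- if its color is smaller. Adding both orders telescopes to the change of the quadratic form.
  set T : E → E → ℝ := fun e f =>
    W e f * (2 * z e - s e) * (if c f < c e then 2 * z f else s f) with hT
  have hTT : ∀ e f, T e f + T f e = W e f * (4 * z e * z f - s e * s f) := by
    intro e f
    simp only [hT, ← hWsymm e f]
    rcases lt_trichotomy (c e) (c f) with h | h | h
    · rw [if_neg h.not_gt, if_pos h]; ring
    · simp [hWdef, h]
    · rw [if_neg h.not_gt, if_pos h]; ring
  have hTsum : 2 * ∑ e, ∑ f, T e f = ∑ e, ∑ f, W e f * (4 * z e * z f - s e * s f) := by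
    rw [two_mul]
    nth_rewrite 2 [Finset.sum_comm]
    simp only [← Finset.sum_add_distrib, hTT]
  have hpos : 0 ≤ ∑ e, ((2 * z e - s e) * a e - 2 * θ * ∑ f, T e f) := by
    refine Finset.sum_nonneg fun e _ => (hstep e).trans_eq ?_
    rw [mul_sub, hT]
    congr 1
    rw [mul_left_comm, Finset.mul_sum]
    congr 1
    refine Finset.sum_congr rfl fun f _ => ?_
    simp only [hWdef]
    ring
  rw [Finset.sum_sub_distrib, ← Finset.mul_sum] at hpos
  have hlin : ∑ e, (2 * z e - s e) * a e = 2 * ∑ e, a e * z e - ∑ e, a e * s e := by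
    rw [Finset.mul_sum, ← Finset.sum_sub_distrib]
    exact Finset.sum_congr rfl fun e _ => by ring
  have hquad : 4 * ∑ e, ∑ f, w e f * z e * z f - ∑ e, ∑ f, w e f * s e * s f
      - 4 * monoWeight (fun e f => w e f * s e * s f) c
      ≤ ∑ e, ∑ f, W e f * (4 * z e * z f - s e * s f) := by
    unfold monoWeight
    simp only [Finset.mul_sum, ← Finset.sum_sub_distrib]
    refine Finset.sum_le_sum fun e _ => Finset.sum_le_sum fun f _ => ?_
    have h₀ := hw e f
    simp only [hWdef]
    rcases hs e with h₁ | h₁ <;> rcases hs f with h₂ | h₂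
    · simp [h₁, h₂, hzs e h₁]
    · simp [h₁, h₂, hzs e h₁]
    · simp [h₁, h₂, hzs f h₂]
    · split_ifs <;> rcases hz e with h₃ | h₃ <;> rcases hz f with h₄ | h₄ <;>
        simp only [h₁, h₂, h₃, h₄] <;> linarith
  have := mul_le_mul_of_nonneg_left hquad hθ
  have hT2 : 2 * θ * ∑ e, ∑ f, T e f
      = θ * ∑ e, ∑ f, W e f * (4 * z e * z f - s e * s f) := by rw [← hTsum]; ring
  rw [hT2, hlin] at hpos
  linarith

/-- Deleting, from a set of nodes, the lighter nodes of all conflicting pairs. -/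
lemma sum_sub_conflicts_le {w : E → E → ℝ} (hw : ∀ e f, 0 ≤ w e f) {a s : E → ℝ}
    (hs : ∀ e, s e = 0 ∨ s e = 1) {M : Finset E}
    (hM : ∀ e, s e = 1 → e ∉ M → ∃ f, s f = 1 ∧ a e ≤ w e f) (ha : ∀ e, 0 ≤ a e) :
    ∑ e, a e * s e - ∑ e, ∑ f, w e f * s e * s f ≤ ∑ e ∈ M, a e := by
  rw [← Finset.sum_sub_distrib, ← Finset.sum_filter_add_sum_filter_not Finset.univ (· ∈ M),
    Finset.filter_mem_eq_inter, Finset.univ_inter]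
  have hterm : ∀ e f, 0 ≤ w e f * s e * s f := by
    intro e f
    have := hw e f
    rcases hs e with h | h <;> rcases hs f with h' | h' <;> simp [h, h', this]
  have h₁ : ∑ e ∈ M, (a e * s e - ∑ f, w e f * s e * s f) ≤ ∑ e ∈ M, a e := by
    refine Finset.sum_le_sum fun e _ => ?_
    have := Finset.sum_nonneg fun f (_ : f ∈ Finset.univ) => hterm e f
    rcases hs e with h | h
    · simp [h, ha e]
    · rw [h] at this
      -- A kept node only loses by its conflicts; below, a deleted node is paid for by its conflict
      -- with one heavier neighbor.
      rw [h, mul_one]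
      linarith
  have h₂ : ∑ e ∈ Finset.univ.filter (· ∉ M), (a e * s e - ∑ f, w e f * s e * s f) ≤ 0 := by
    refine Finset.sum_nonpos fun e he => ?_
    rcases hs e with h | h
    · simp [h]
    · obtain ⟨f, hf, hle⟩ := hM e h (Finset.mem_filter.1 he).2
      have := Finset.single_le_sum (fun f _ => hterm e f) (Finset.mem_univ f)
      simp only [h, hf, mul_one] at this ⊢
      linarith
  linarith

end MonoWeight

/-! ### Updating one color class after another -/

section Sweep

variable {E : Type v} {O : Type*} (choice : E → (E → O) → O) (ψ : E → ℕ) (init : E → O)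

/-- The nodes of color `0`, then those of color `1`, and so on, update their values. -/
def sweep : ℕ → E → O
  | 0 => init
  | j + 1 => fun e => if ψ e = j then choice e (sweep j) else sweep j e

lemma sweep_eq (j : ℕ) (e : E) :
    sweep choice ψ init j e
      = if ψ e < j then choice e (sweep choice ψ init (ψ e)) else init e := by
  induction j with
  | zero => rfl
  | succ j ih =>
    rw [sweep]
    dsimp only
    rcases lt_trichotomy (ψ e) j with h | h | h
    · rw [if_neg h.ne, ih, if_pos h, if_pos (by omega)]
    · rw [if_pos h, if_pos (by omega), h]
    · rw [if_neg h.ne', ih, if_neg (by omega), if_neg (by omega)]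

/-- A node changes only at its own turn. So what it sees at that moment is final on smaller colors
and initial on all others, which describes the result by one equation without intermediate states.
-/
lemma sweep_eq_choice {m : ℕ} (hψ : ∀ e, ψ e < m) (e : E) :
    sweep choice ψ init m e
      = choice e fun f => if ψ f < ψ e then sweep choice ψ init m f else init f := by
  rw [sweep_eq, if_pos (hψ e)]
  congr 1
  funext f
  rw [sweep_eq, sweep_eq (j := m), if_pos (hψ f)]

end Sweep

/-! ### Local computation of defective colorings -/

/-- Parameters of a defective coloring with `B ^ 2` colors, computed from a coloring with `N`
colors. -/
structure SplitParams (N : ℕ) where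
  /-- The number of colors is `B ^ 2`. -/
  B : ℕ
  /-- The first prime. -/
  q₁ : ℕ
  /-- The second prime. -/
  q₂ : ℕ
  /-- The length of the messages in the first code. -/
  D₁ : ℕ
  /-- The length of the messages in the second code. -/
  D₂ : ℕ
  B_pos : 0 < B
  prime₁ : q₁.Prime
  prime₂ : q₂.Prime
  le_pow₁ : N ≤ q₁ ^ D₁
  le_pow₂ : q₁ ^ 2 ≤ q₂ ^ D₂
  le₁ : 2 * B * D₁ ≤ q₁
  le₂ : 2 * B * D₂ ≤ q₂

/-- The number of exchanges that a rounding step takes. -/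
def SplitParams.rounds {N : ℕ} (p : SplitParams N) : ℕ := 2 * (2 + p.q₂ ^ 2) + p.B ^ 2

namespace LocalInstance

open scoped Classical

variable {k : ℕ} {j : ℕ}

lemma IsLocal.sweep {O : Type*} {ψ : ∀ I : LocalInstance.{u, v} k, I.E → ℕ} (hψ : IsLocal j ψ)
    {init : ∀ I : LocalInstance.{u, v} k, I.E → O} (hinit : IsLocal j init)
    {choice : ∀ I : LocalInstance.{u, v} k, I.E → (I.E → O) → O}
    (hchoice : ∀ i g, j ≤ i → IsLocal i g → IsLocal (i + 1) fun I e => choice I e (g I)) (m : ℕ) :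
    IsLocal (j + m) fun I => sweep (choice I) (ψ I) (init I) m := by
  induction m with
  | zero => exact hinit
  | succ m ih =>
    have h := ((hψ.mono (show j ≤ j + (m + 1) by omega)).pair (hchoice _ _ (Nat.le_add_right j m) ih)).comp₂
      ih.succ fun x y => if x.1 = m then x.2 else y
    exact h

lemma exists_isLocal_recolor {q D N : ℕ} [Fact q.Prime] (hN : N ≤ q ^ D)
    {W : ∀ I : LocalInstance.{u, v} k, I.E → I.E → ℝ} (hW : IsLocalPair j W)
    (hnonneg : ∀ I e f, 0 ≤ W I e f) {c : ∀ I : LocalInstance.{u, v} k, I.E → ℕ}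
    (hc : IsLocal j c) (hcN : ∀ I e, c I e < N) :
    ∃ c' : ∀ I : LocalInstance.{u, v} k, I.E → ℕ, IsLocal (j + 1) c' ∧
      (∀ I e, c' I e < q ^ 2) ∧ ∀ I, monoWeight (W I) (c' I)
        ≤ monoWeight (W I) (c I) + D / q * ∑ e, ∑ f, W I e f := by
  obtain ⟨code, hcode⟩ := exists_code hN
  let F : ∀ I : LocalInstance.{u, v} k, I.E → ZMod q → ℝ := fun I e =>
    ∑ f, fun y => if c I e ≠ c I f ∧ code (c I e) y = code (c I f) y then W I e f else 0
  have hF : IsLocal (j + 1) F :=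
    (hW.map hc (fun x x' r y => if x ≠ x' ∧ code x y = code x' y then r else 0) (by
      intro p q
      funext y
      simp)).sum
  let x : ∀ I : LocalInstance.{u, v} k, I.E → ZMod q := fun I e => argMin (F I e)
  have hx : IsLocal (j + 1) x := hF.comp argMin
  let i : ZMod q × ZMod q → ℕ := fun y => (Fintype.equivFin (ZMod q × ZMod q) y : ℕ)
  have hi : Function.Injective i :=
    Fin.val_injective.comp (Fintype.equivFin (ZMod q × ZMod q)).injective
  refine ⟨fun I e => i (x I e, code (c I e) (x I e)),
    hc.succ.comp₂ hx fun z y => i (y, code z y), fun I e => ?_, fun I => ?_⟩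
  · refine (Fin.is_lt _).trans_eq ?_
    rw [Fintype.card_prod, ZMod.card, sq]
  · rw [monoWeight_comp_injective (W := W I)
      (fun e => (x I e, code (c I e) (x I e))) hi]
    refine monoWeight_recolor (hnonneg I) (hcN I) (fun c hc c' hc' h => ?_) fun e y => ?_
    · convert hcode c hc c' hc' h
    · have h := apply_argMin_le (F I e) y
      simp only [F, Finset.sum_apply] at h
      convert h

lemma exists_isLocal_greedy {B m : ℕ} (hB : 0 < B)
    {W : ∀ I : LocalInstance.{u, v} k, I.E → I.E → ℝ} (hW : IsLocalPair j W)
    (hnonneg : ∀ I e f, 0 ≤ W I e f) (hsymm : ∀ I e f, W I e f = W I f e)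
    {c : ∀ I : LocalInstance.{u, v} k, I.E → ℕ} (hc : IsLocal j c) (hcm : ∀ I e, c I e < m) :
    ∃ g : ∀ I : LocalInstance.{u, v} k, I.E → Fin B, IsLocal (j + m) g ∧
      ∀ I, monoWeight (W I) (g I)
        ≤ monoWeight (W I) (c I) + 1 / B * ∑ e, ∑ f, W I e f := by
  have : Nonempty (Fin B) := ⟨⟨0, hB⟩⟩
  let F : ∀ I : LocalInstance.{u, v} k, I.E → (I.E → Fin B) → Fin B → ℝ := fun I e g =>
    ∑ f, fun b => if c I f < c I e ∧ g f = b then W I e f else 0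
  let choice : ∀ I : LocalInstance.{u, v} k, I.E → (I.E → Fin B) → Fin B := fun I e g =>
    argMin (F I e g)
  have hchoice : ∀ i g, j ≤ i → IsLocal i g → IsLocal (i + 1) fun I e => choice I e (g I) := by
    intro i g hi hg
    have h : IsLocal (i + 1) fun I e => F I e (g I) :=
      ((hW.mono hi).map ((hc.mono hi).pair hg)
        (fun x x' r b => if x'.1 < x.1 ∧ x'.2 = b then r else 0) (by
          intro p q
          funext b
          simp)).sum
    exact h.comp argMin
  refine ⟨_, hc.sweep (isLocal_const (⟨0, hB⟩ : Fin B)) hchoice m, fun I => ?_⟩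
  refine monoWeight_greedy (hnonneg I) (hsymm I) hB fun e b => ?_
  set g := sweep (choice I) (c I) (fun _ => ⟨0, hB⟩) m with hg
  have h := sweep_eq_choice (choice I) (c I) (fun _ => ⟨0, hB⟩) (hcm I) e
  rw [← hg] at h
  have h' := apply_argMin_le
    (F I e fun f => if c I f < c I e then g f else ⟨0, hB⟩) b
  change g e = argMin (F I e fun f => if c I f < c I e then g f else ⟨0, hB⟩) at h
  rw [← h] at h'
  simp only [F, Finset.sum_apply] at h'
  refine le_trans (le_of_eq ?_) (h'.trans (le_of_eq ?_)) <;>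
  · refine Finset.sum_congr rfl fun f _ => ?_
    by_cases hf : c I f < c I e <;> simp [hf]

/-- The two recolorings lose `1 / (2 * B)` each and the greedy sweep loses `1 / B`. The second
recoloring shortens the sweep from `q₁ ^ 2` to `q₂ ^ 2` exchanges. -/
lemma exists_isLocal_digit (p : SplitParams k)
    {W : ∀ I : LocalInstance.{u, v} k, I.E → I.E → ℝ} (hW : IsLocalPair j W)
    (hnonneg : ∀ I e f, 0 ≤ W I e f) (hsymm : ∀ I e f, W I e f = W I f e) :
    ∃ g : ∀ I : LocalInstance.{u, v} k, I.E → Fin p.B, IsLocal (j + (2 + p.q₂ ^ 2)) g ∧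
      ∀ I, monoWeight (W I) (g I) ≤ monoWeight (W I) (fun e => I.χ (Sum.inr e))
        + 2 / p.B * ∑ e, ∑ f, W I e f := by
  have := Fact.mk p.prime₁
  have := Fact.mk p.prime₂
  obtain ⟨c₁, hc₁, hlt₁, hmono₁⟩ := exists_isLocal_recolor p.le_pow₁ hW hnonneg
    ((isLocal_color.{u, v}.comp Fin.val).mono (Nat.zero_le j)) fun I e => Fin.is_lt _
  obtain ⟨c₂, hc₂, hlt₂, hmono₂⟩ := exists_isLocal_recolor p.le_pow₂ (hW.mono (Nat.le_succ j))
    hnonneg hc₁ hlt₁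
  obtain ⟨g, hg, hmono⟩ := exists_isLocal_greedy p.B_pos (hW.mono (show j ≤ j + 1 + 1 by omega))
    hnonneg hsymm hc₂ hlt₂
  refine ⟨g, by rwa [show j + (2 + p.q₂ ^ 2) = j + 1 + 1 + p.q₂ ^ 2 by ring], fun I => ?_⟩
  have hfrac : ∀ {q D : ℕ}, q.Prime → 2 * p.B * D ≤ q → (D : ℝ) / q ≤ 1 / (2 * p.B) := by
    intro q D hq h
    have hq' : (0 : ℝ) < q := by exact_mod_cast hq.pos
    have hB' : (0 : ℝ) < p.B := by exact_mod_cast p.B_pos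
    rw [div_le_div_iff₀ hq' (by positivity), mul_comm, one_mul]
    exact_mod_cast h
  have hsum : 0 ≤ ∑ e, ∑ f, W I e f :=
    Finset.sum_nonneg fun e _ => Finset.sum_nonneg fun f _ => hnonneg I e f
  have h₁ := hmono₁ I
  rw [monoWeight_comp_injective (W := W I) (fun e => I.χ (Sum.inr e)) Fin.val_injective] at h₁
  have h₂ := mul_le_mul_of_nonneg_right (hfrac p.prime₁ p.le₁) hsum
  have h₃ := mul_le_mul_of_nonneg_right (hfrac p.prime₂ p.le₂) hsum
  have h₄ := hmono₂ I
  have h₅ := hmono I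
  have h₆ : 2 / (p.B : ℝ) * ∑ e, ∑ f, W I e f = 1 / (2 * p.B) * ∑ e, ∑ f, W I e f
      + 1 / (2 * p.B) * ∑ e, ∑ f, W I e f + 1 / p.B * ∑ e, ∑ f, W I e f := by
    have hB' : (p.B : ℝ) ≠ 0 := by exact_mod_cast p.B_pos.ne'
    field_simp
    ring
  linarith

/-- The second digit is computed for the pairs that agree in the first, so the defects `2 / B`
multiply. A single pass to `B ^ 2` colors would need a prime of order at least `B ^ 2` and thus a
sweep of length at least of order `B ^ 4`; two digits keep it at `B ^ 2` up to logarithms. -/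
lemma exists_isLocal_classes (p : SplitParams k)
    {W : ∀ I : LocalInstance.{u, v} k, I.E → I.E → ℝ} (hW : IsLocalPair j W)
    (hnonneg : ∀ I e f, 0 ≤ W I e f) (hsymm : ∀ I e f, W I e f = W I f e) :
    ∃ c : ∀ I : LocalInstance.{u, v} k, I.E → ℕ, IsLocal (j + 2 * (2 + p.q₂ ^ 2)) c ∧
      (∀ I e, c I e < p.B ^ 2) ∧
      ∀ I, (∀ e f, W I e f ≠ 0 → I.χ (Sum.inr e) ≠ I.χ (Sum.inr f)) →
        monoWeight (W I) (c I) ≤ 4 / p.B ^ 2 * ∑ e, ∑ f, W I e f := by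
  obtain ⟨g, hg, hmono⟩ := exists_isLocal_digit p hW hnonneg hsymm
  have hW' : IsLocalPair (j + (2 + p.q₂ ^ 2)) fun (I : LocalInstance.{u, v} k) e f =>
      if g I e = g I f then W I e f else 0 :=
    (hW.mono (Nat.le_add_right _ _)).map hg (fun x x' r => if x = x' then r else 0) (by simp)
  obtain ⟨g', hg', hmono'⟩ := exists_isLocal_digit p hW'
    (fun I e f => by split_ifs; exacts [hnonneg I e f, le_rfl])
    (fun I e f => by simp only [hsymm I e f, eq_comm (a := g I e)])
  let i : Fin p.B × Fin p.B → ℕ := fun y => (Fintype.equivFin (Fin p.B × Fin p.B) y : ℕ)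
  have hi : Function.Injective i :=
    Fin.val_injective.comp (Fintype.equivFin (Fin p.B × Fin p.B)).injective
  refine ⟨fun I e => i (g I e, g' I e), ?_, fun I e => ?_, fun I hχ => ?_⟩
  · rw [show j + 2 * (2 + p.q₂ ^ 2) = j + (2 + p.q₂ ^ 2) + (2 + p.q₂ ^ 2) by ring]
    exact (hg.mono (Nat.le_add_right _ _)).comp₂ hg' fun x y => i (x, y)
  · refine (Fin.is_lt _).trans_eq ?_
    rw [Fintype.card_prod, Fintype.card_fin, sq]
  · have hzero : ∀ W' : I.E → I.E → ℝ, (∀ e f, W' e f ≠ 0 → W I e f ≠ 0) →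
        monoWeight W' (fun e => I.χ (Sum.inr e)) = 0 := by
      refine fun W' h => Finset.sum_eq_zero fun e _ => Finset.sum_eq_zero fun f _ => ?_
      split_ifs with h'
      · by_contra h''
        exact hχ e f (h e f h'') h'
      · rfl
    rw [monoWeight_comp_injective (W := W I) (fun e => (g I e, g' I e)) hi, monoWeight_pair]
    have h₁ := hmono I
    rw [hzero _ fun _ _ h => h, zero_add] at h₁
    have h₂ := hmono' I
    rw [hzero _ fun e f h h' => h (by simp [h']), zero_add] at h₂
    have hB' : (0 : ℝ) < p.B := by exact_mod_cast p.B_pos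
    have h₃ : (∑ e, ∑ f, if g I e = g I f then W I e f else 0)
        ≤ 2 / p.B * ∑ e, ∑ f, W I e f := by
      refine le_trans (le_of_eq ?_) h₁
      unfold monoWeight
      refine Finset.sum_congr rfl fun e _ => Finset.sum_congr rfl fun f _ => ?_
      by_cases h : g I e = g I f <;> simp [h]
    calc _ ≤ _ := by convert h₂
      _ ≤ 2 / p.B * (2 / p.B * ∑ e, ∑ f, W I e f) :=
        mul_le_mul_of_nonneg_left h₃ (by positivity)
      _ = _ := by field_simp; ring

/-! ### Conflicts and a single rounding step -/

/-- The weight of the lighter of two distinct hyperedges that meet. -/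
noncomputable def conflict (I : LocalInstance.{u, v} k) (e f : I.E) : ℝ :=
  if I.Meets e f ∧ e ≠ f then min (I.a e : ℝ) (I.a f : ℝ) else 0

lemma conflict_nonneg (I : LocalInstance.{u, v} k) (e f : I.E) : 0 ≤ I.conflict e f := by
  unfold conflict
  split_ifs
  exacts [le_min (I.a e).2 (I.a f).2, le_rfl]

lemma conflict_comm (I : LocalInstance.{u, v} k) (e f : I.E) :
    I.conflict e f = I.conflict f e := by
  simp only [conflict, meets_comm (e := e), ne_comm (a := e), min_comm (I.a e : ℝ)]

lemma isLocalPair_conflict :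
    IsLocalPair 0 fun (I : LocalInstance.{u, v} k) e f => I.conflict e f := by
  have h := (isLocalPair_meets (j := 0) (1 : ℝ)).map
    (isLocal_weight.{u, v}.pair (isLocal_ident (k := k)))
    (fun x y r => if x.2 = y.2 then 0 else r * min (x.1 : ℝ) (y.1 : ℝ)) (by simp)
  convert h using 4 with I e f
  simp only [conflict, I.ident.injective.eq_iff, Sum.inr.injEq]
  by_cases h₁ : I.Meets e f <;> by_cases h₂ : e = f <;> simp [h₁, h₂]

/-- The colors of distinct hyperedges that meet are distinct. -/
def Proper (I : LocalInstance.{u, v} k) : Prop :=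
  ∀ e f, I.Meets e f → e ≠ f → I.χ (Sum.inr e) ≠ I.χ (Sum.inr f)

/-- The weight of a set of hyperedges, given by its indicator function. -/
noncomputable def util (I : LocalInstance.{u, v} k) (s : I.E → ℝ) : ℝ := ∑ e, (I.a e : ℝ) * s e

/-- The weight of the conflicts in a set of hyperedges, given by its indicator function. -/
noncomputable def cost (I : LocalInstance.{u, v} k) (s : I.E → ℝ) : ℝ :=
  ∑ e, ∑ f, I.conflict e f * s e * s f

lemma cost_nonneg (I : LocalInstance.{u, v} k) {s : I.E → ℝ} (hs : ∀ e, s e = 0 ∨ s e = 1) :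
    0 ≤ I.cost s := by
  refine Finset.sum_nonneg fun e _ => Finset.sum_nonneg fun f _ => ?_
  have := I.conflict_nonneg e f
  rcases hs e with h | h <;> rcases hs f with h' | h' <;> simp [h, h', this]

/-- `quadratic_rounding` loses `4 * θ` times the monochromatic cost, and the classes make that at
most `4 / B ^ 2` of the cost, whence `16 / B ^ 2`. -/
lemma exists_isLocal_round (p : SplitParams k) {s : ∀ I : LocalInstance.{u, v} k, I.E → ℝ}
    (hs : IsLocal j s) (hs01 : ∀ I e, s I e = 0 ∨ s I e = 1) {θ : ℝ} (hθ : 0 ≤ θ) :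
    ∃ z : ∀ I : LocalInstance.{u, v} k, I.E → ℝ, IsLocal (j + p.rounds) z ∧
      (∀ I e, z I e = 0 ∨ z I e = 1) ∧ ∀ I : LocalInstance.{u, v} k, I.Proper →
        I.util (s I) - θ * (1 + 16 / p.B ^ 2) * I.cost (s I)
          ≤ 2 * I.util (z I) - 4 * θ * I.cost (z I) := by
  have hW : IsLocalPair j fun (I : LocalInstance.{u, v} k) e f =>
      I.conflict e f * s I e * s I f :=
    (isLocalPair_conflict.mono (Nat.zero_le j)).map hs (fun x y r => r * x * y) (by simp)
  obtain ⟨c, hc, hcB, hmono⟩ := exists_isLocal_classes p hW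
    (fun I e f => by
      have := I.conflict_nonneg e f
      rcases hs01 I e with h | h <;> rcases hs01 I f with h' | h' <;> simp [h, h', this])
    (fun I e f => by rw [I.conflict_comm]; ring)
  set j' := j + 2 * (2 + p.q₂ ^ 2) with hj'
  have hjj' : j ≤ j' := Nat.le_add_right _ _
  let d : ∀ I : LocalInstance.{u, v} k, I.E → (I.E → ℝ) → ℝ := fun I e g =>
    I.a e - 2 * θ * ∑ f, (if c I e = c I f then 0 else I.conflict e f * s I e * s I f) * g f
  -- The sweep starts at `s` and moves each present hyperedge from `1` to `0` or `2`; halving at the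
  -- end gives the indicator `z` at the doubled scale.
  let choice : ∀ I : LocalInstance.{u, v} k, I.E → (I.E → ℝ) → ℝ := fun I e g =>
    if s I e = 0 then 0 else if 0 ≤ d I e g then 2 else 0
  have hchoice : ∀ i g, j' ≤ i → IsLocal i g → IsLocal (i + 1) fun I e => choice I e (g I) := by
    intro i g hi hg
    have h : IsLocal (i + 1) fun I e =>
        ∑ f, (if c I e = c I f then 0 else I.conflict e f * s I e * s I f) * g I f :=
      ((hW.mono (hjj'.trans hi)).map ((hc.mono hi).pair hg)
        (fun x y r => (if x.1 = y.1 then 0 else r) * y.2) (by simp)).sum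
    exact (((isLocal_weight.{u, v} (k := k)).mono (Nat.zero_le _)).pair
      (hs.mono (show j ≤ i + 1 by omega))).comp₂ h fun x y =>
        if x.2 = 0 then (0 : ℝ) else if 0 ≤ (x.1 : ℝ) - 2 * θ * y then 2 else 0
  have hsweep := hc.sweep (hs.mono hjj') hchoice (p.B ^ 2)
  refine ⟨fun I e => sweep (choice I) (c I) (s I) (p.B ^ 2) e / 2, ?_, fun I e => ?_,
    fun I hI => ?_⟩
  · have h := hsweep.comp fun x => x / 2
    rwa [hj', add_assoc] at h
  · dsimp only
    rw [sweep_eq_choice _ _ _ (hcB I)]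
    simp only [choice]
    split_ifs <;> norm_num
  · set g := sweep (choice I) (c I) (s I) (p.B ^ 2) with hg
    have hgeq : ∀ e, g e = choice I e fun f => if c I f < c I e then g f else s I f :=
      sweep_eq_choice (choice I) (c I) (s I) (hcB I)
    have h := quadratic_rounding (w := I.conflict) (a := fun e => (I.a e : ℝ)) (s := s I)
      (z := fun e => g e / 2) (c := c I) I.conflict_nonneg I.conflict_comm (hs01 I)
      (fun e => by
        rw [hgeq]
        simp only [choice]
        split_ifs <;> norm_num)
      (fun e he => by
        rw [hgeq]
        simp [choice, he])
      hθ
      (fun e => by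
        have h₁ := hgeq e
        simp only [mul_div_cancel₀ _ (two_ne_zero' ℝ)]
        change 0 ≤ (g e - s I e) * d I e fun f => if c I f < c I e then g f else s I f
        rw [h₁]
        simp only [choice]
        rcases hs01 I e with h₂ | h₂
        · simp [h₂]
        · rw [if_neg (by simp [h₂]), h₂]
          split_ifs with h₃
          · linarith
          · linarith)
    have hm := hmono I fun e f hne => by
      refine hI e f ?_ ?_
      · by_contra hmeets
        simp [conflict, hmeets] at hne
      · rintro rfl
        simp [conflict] at hne
    change I.util (s I) - θ * I.cost (s I) - 4 * θ * _
      ≤ 2 * I.util (fun e => g e / 2) - 4 * θ * I.cost fun e => g e / 2 at h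
    change _ ≤ 4 / (p.B : ℝ) ^ 2 * I.cost (s I) at hm
    have h₁ := mul_le_mul_of_nonneg_left hm (mul_nonneg zero_le_four hθ)
    have h₂ : θ * (1 + 16 / (p.B : ℝ) ^ 2) * I.cost (s I)
        = θ * I.cost (s I) + 4 * θ * (4 / (p.B : ℝ) ^ 2 * I.cost (s I)) := by ring
    linarith

end LocalInstance

/-! ### All rounding steps, and the matching -/

namespace LocalInstance

open scoped Classical

variable {k : ℕ}

/-- The right side is `2 ^ K` times the potential of the fractional point `2 ^ i / 2 ^ K * s`, with
cost multiplier `2 - i / K`. Lowering the multiplier by `1 / K` pays for the factor `1 + 16 / B ^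
2`, because it is at most `2` and `32 / B ^ 2 ≤ 1 / K`. -/
lemma exists_isLocal_rounding (p : SplitParams k) {K : ℕ} (hK : 0 < K) (hB : 32 * K ≤ p.B ^ 2)
    {i : ℕ} (hi : i ≤ K) :
    ∃ s : ∀ I : LocalInstance.{u, v} k, I.E → ℝ, IsLocal (i * p.rounds) s ∧
      (∀ I e, s I e = 0 ∨ s I e = 1) ∧ ∀ I : LocalInstance.{u, v} k, I.Proper →
        I.util (fun _ => 1) - 2 / 2 ^ K * I.cost (fun _ => 1)
          ≤ 2 ^ i * (I.util (s I) - (2 - i / K) * (2 ^ i / 2 ^ K) * I.cost (s I)) := by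
  have hK' : (0 : ℝ) < K := by exact_mod_cast hK
  induction i with
  | zero =>
    refine ⟨fun _ _ => 1, isLocal_const 1, fun _ _ => Or.inr rfl, fun I _ => le_of_eq ?_⟩
    simp [div_eq_mul_inv]
  | succ i ih =>
    obtain ⟨s, hs, hs01, hle⟩ := ih (by omega)
    set μ : ℝ := 2 - (i + 1 : ℕ) / K with hμ
    have hμ0 : 0 ≤ μ := by
      have : ((i + 1 : ℕ) : ℝ) / K ≤ 1 := (div_le_one hK').2 (by exact_mod_cast hi)
      linarith
    have hμ2 : μ ≤ 2 := sub_le_self _ (by positivity)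
    obtain ⟨z, hz, hz01, hround⟩ := exists_isLocal_round p hs hs01
      (show 0 ≤ μ * (2 ^ i / 2 ^ K) by positivity)
    refine ⟨z, by rwa [Nat.succ_mul], hz01, fun I hI => (hle I hI).trans ?_⟩
    have hstep : μ * (1 + 16 / p.B ^ 2) ≤ 2 - i / K := by
      have hB0 : (0 : ℝ) < p.B := by exact_mod_cast p.B_pos
      have hB' : (32 : ℝ) * K ≤ p.B ^ 2 := by exact_mod_cast hB
      have h₁ : (32 : ℝ) / p.B ^ 2 ≤ 1 / K := by
        rw [div_le_div_iff₀ (by positivity) hK']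
        linarith
      have h₂ : μ * (16 / p.B ^ 2) ≤ 2 * (16 / p.B ^ 2) :=
        mul_le_mul_of_nonneg_right hμ2 (by positivity)
      have h₃ : (2 : ℝ) * (16 / p.B ^ 2) = 32 / p.B ^ 2 := by ring
      have h₄ : μ = 2 - i / K - 1 / K := by rw [hμ]; push_cast; ring
      linarith
    have h₁ := hround I hI
    have h₂ : μ * (2 ^ i / 2 ^ K) * (1 + 16 / p.B ^ 2) * I.cost (s I)
        ≤ (2 - i / K) * (2 ^ i / 2 ^ K) * I.cost (s I) := by
      refine mul_le_mul_of_nonneg_right ?_ (I.cost_nonneg (hs01 I))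
      rw [mul_right_comm]
      exact mul_le_mul_of_nonneg_right hstep (by positivity)
    have h₃ : (2 : ℝ) ^ (i + 1) * (I.util (z I) - μ * (2 ^ (i + 1) / 2 ^ K) * I.cost (z I))
        = 2 ^ i * (2 * I.util (z I) - 4 * (μ * (2 ^ i / 2 ^ K)) * I.cost (z I)) := by ring
    rw [h₃]
    exact mul_le_mul_of_nonneg_left (by linarith) (by positivity)

/-- The hyperedge `f` is heavier than `e`, with ties broken by identifiers. -/
def Heavier (I : LocalInstance.{u, v} k) (e f : I.E) : Prop :=
  I.a e < I.a f ∨ I.a e = I.a f ∧ I.ident (Sum.inr e) < I.ident (Sum.inr f)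

lemma heavier_or_heavier (I : LocalInstance.{u, v} k) {e f : I.E} (h : e ≠ f) :
    I.Heavier e f ∨ I.Heavier f e := by
  rcases lt_trichotomy (I.a e) (I.a f) with ha | ha | ha
  · exact Or.inl (Or.inl ha)
  · have hne : I.ident (Sum.inr e) ≠ I.ident (Sum.inr f) := fun h' =>
      h (Sum.inr_injective (I.ident.injective h'))
    exact hne.lt_or_gt.imp (fun h' => Or.inr ⟨ha, h'⟩) fun h' => Or.inr ⟨ha.symm, h'⟩
  · exact Or.inr (Or.inl ha)

lemma exists_isLocal_matching {j : ℕ} {s : ∀ I : LocalInstance.{u, v} k, I.E → ℝ}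
    (hs : IsLocal j s) (hs01 : ∀ I e, s I e = 0 ∨ s I e = 1) :
    ∃ φ : ∀ I : LocalInstance.{u, v} k, I.E → Bool, IsLocal (j + 1) φ ∧
      ∀ I : LocalInstance.{u, v} k,
        I.H.IsMatching (Finset.univ.filter fun e => φ I e = true) ∧
        I.util (s I) - I.cost (s I)
          ≤ ∑ e ∈ Finset.univ.filter (fun e => φ I e = true), (I.a e : ℝ) := by
  -- Counting the heavier selected neighbors, instead of asking whether one exists, makes
  -- `IsLocalPair.sum` applicable.
  let n : ∀ I : LocalInstance.{u, v} k, I.E → ℕ := fun I e =>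
    ∑ f, if s I f = 1 ∧ I.Heavier e f then (if I.Meets e f then 1 else 0) else 0
  have hn : IsLocal (j + 1) n := by
    convert ((isLocalPair_meets (j := j) (1 : ℕ)).map
      (hs.pair ((isLocal_weight.{u, v}.pair isLocal_ident).mono (Nat.zero_le j)))
      (fun x y b => if y.1 = 1 ∧ (x.2.1 < y.2.1 ∨ x.2.1 = y.2.1 ∧ x.2.2 < y.2.2) then b else 0)
      (by simp)).sum
    exact Iff.rfl
  have hn0 : ∀ I e, n I e = 0 ↔ ∀ f, s I f = 1 → I.Heavier e f → ¬ I.Meets e f := by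
    intro I e
    simp only [n, Finset.sum_eq_zero_iff, Finset.mem_univ, true_imp_iff]
    refine forall_congr' fun f => ?_
    by_cases h₁ : s I f = 1 <;> by_cases h₂ : I.Heavier e f <;> by_cases h₃ : I.Meets e f <;>
      simp [h₁, h₂, h₃]
  refine ⟨fun I e => decide (s I e = 1 ∧ n I e = 0), hs.succ.comp₂ hn fun x y =>
    decide (x = 1 ∧ y = 0), fun I => ⟨?_, ?_⟩⟩
  · intro e he f hf hne
    simp only [Finset.coe_filter, Finset.mem_univ, true_and, decide_eq_true_eq,
      Set.mem_ofPred_eq, hn0] at he hf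
    rw [Function.onFun, Finset.disjoint_left]
    intro x hxe hxf
    rcases I.heavier_or_heavier hne with h | h
    · exact he.2 f hf.1 h ⟨x, hxe, hxf⟩
    · exact hf.2 e he.1 h ⟨x, hxf, hxe⟩
  · refine sum_sub_conflicts_le I.conflict_nonneg (hs01 I) (fun e he heM => ?_)
      fun e => (I.a e).2
    simp only [Finset.mem_filter, Finset.mem_univ, true_and, decide_eq_true_eq, he, hn0] at heM
    push Not at heM
    obtain ⟨f, hf, hh, hm⟩ := heM
    refine ⟨f, hf, ?_⟩
    have hne : e ≠ f := by
      rintro rfl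
      rcases hh with h | h
      exacts [lt_irrefl _ h, lt_irrefl _ h.2]
    have hle : (I.a e : ℝ) ≤ I.a f := by
      rcases hh with h | h
      exacts [by exact_mod_cast h.le, by rw [h.1]]
    rw [conflict, if_pos ⟨hm, hne⟩, min_eq_left hle]

lemma card_meets_le (I : LocalInstance.{u, v} k) {r Δ : ℕ} (hr : I.H.RankLE r)
    (hΔ : I.H.DegreeLE Δ) (e : I.E) :
    (Finset.univ.filter fun f => I.Meets e f).card ≤ r * Δ := by
  have hsub : (Finset.univ.filter fun f => I.Meets e f)
      ⊆ (I.H.verts e).biUnion fun x => Finset.univ.filter fun f => x ∈ I.H.verts f := by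
    intro f hf
    obtain ⟨x, hx⟩ := (Finset.mem_filter.1 hf).2
    exact Finset.mem_biUnion.2 ⟨x, hx.1, Finset.mem_filter.2 ⟨Finset.mem_univ f, hx.2⟩⟩
  refine (Finset.card_le_card hsub).trans ((Finset.card_biUnion_le_card_mul _ _ Δ
    fun x _ => ?_).trans (Nat.mul_le_mul_right Δ (hr e)))
  refine le_of_eq_of_le ?_ (hΔ x).2
  rw [← Set.ncard_coe_finset]
  congr 1
  ext f
  simp [MultiHypergraph.star]

lemma cost_one_le (I : LocalInstance.{u, v} k) {r Δ : ℕ} (hr : I.H.RankLE r)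
    (hΔ : I.H.DegreeLE Δ) : I.cost (fun _ => 1) ≤ r * Δ * ∑ e, (I.a e : ℝ) := by
  unfold cost
  simp only [mul_one]
  rw [Finset.mul_sum]
  refine Finset.sum_le_sum fun e _ => ?_
  calc ∑ f, I.conflict e f ≤ ∑ f, if I.Meets e f then (I.a e : ℝ) else 0 := by
        refine Finset.sum_le_sum fun f _ => ?_
        unfold conflict
        by_cases h : I.Meets e f
        · rw [if_pos h]
          split_ifs
          exacts [min_le_left _ _, (I.a e).2]
        · rw [if_neg fun h' => h h'.1, if_neg h]
    _ = ((Finset.univ.filter fun f => I.Meets e f).card : ℝ) * I.a e := by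
        rw [← Finset.sum_filter, Finset.sum_const, nsmul_eq_mul]
    _ ≤ r * Δ * I.a e := by
        refine mul_le_mul_of_nonneg_right ?_ (I.a e).2
        exact_mod_cast I.card_meets_le hr hΔ e

/-- The lower bound on `2 ^ K` keeps half of the total weight in the initial potential; the upper
bound turns `S / 2 ≤ 2 ^ K * U` into `U ≥ S / (16 * (r * Δ))`. -/
lemma exists_isLocal_heavy_matching (p : SplitParams k) {K r Δ : ℕ} (hK : 0 < K)
    (hB : 32 * K ≤ p.B ^ 2) (hK₁ : 4 * (r * Δ) ≤ 2 ^ K) (hK₂ : 2 ^ K ≤ 8 * (r * Δ)) :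
    ∃ φ : ∀ I : LocalInstance.{u, v} k, I.E → Bool, IsLocal (K * p.rounds + 1) φ ∧
      ∀ I : LocalInstance.{u, v} k, I.Proper → I.H.RankLE r → I.H.DegreeLE Δ →
        I.H.IsMatching (Finset.univ.filter fun e => φ I e = true) ∧
        1 / 16 * ((∑ e, (I.a e : ℝ)) / (r * Δ))
          ≤ ∑ e ∈ Finset.univ.filter (fun e => φ I e = true), (I.a e : ℝ) := by
  obtain ⟨s, hs, hs01, hle⟩ := exists_isLocal_rounding.{u, v} p hK hB le_rfl
  obtain ⟨φ, hφ, h⟩ := exists_isLocal_matching hs hs01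
  refine ⟨φ, hφ, fun I hI hr hΔ => ⟨(h I).1, le_trans ?_ (h I).2⟩⟩
  have hK' : (K : ℝ) ≠ 0 := by exact_mod_cast hK.ne'
  have hle := hle I hI
  rw [div_self hK', div_self (by positivity)] at hle
  have hcost := I.cost_one_le hr hΔ
  have hutil : I.util (fun _ => 1) = ∑ e, (I.a e : ℝ) := by simp [util]
  rw [hutil] at hle
  set S := ∑ e, (I.a e : ℝ)
  have hS : 0 ≤ S := Finset.sum_nonneg fun e _ => (I.a e).2
  set U := I.util (s I) - I.cost (s I) with hU
  have h₁ : (4 : ℝ) * (r * Δ) ≤ 2 ^ K := by exact_mod_cast hK₁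
  have h₂ : (2 : ℝ) ^ K ≤ 8 * (r * Δ) := by exact_mod_cast hK₂
  have hpow : (0 : ℝ) < 2 ^ K := by positivity
  have h₃ : 2 / 2 ^ K * I.cost (fun _ => 1) ≤ S / 2 := by
    rw [div_mul_eq_mul_div, div_le_div_iff₀ hpow two_pos]
    have := mul_le_mul_of_nonneg_right h₁ hS
    linarith
  have h₄ : S / 2 ≤ 2 ^ K * U := by
    have : (2 : ℝ) ^ K * (I.util (s I) - (2 - 1) * 1 * I.cost (s I)) = 2 ^ K * U := by
      rw [hU]; ring
    linarith
  -- Needed to replace the factor `2 ^ K` of `U` by its upper bound.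
  have hU0 : 0 ≤ U := by
    by_contra hneg
    have := mul_neg_of_pos_of_neg hpow (not_le.1 hneg)
    linarith
  have h₅ := mul_le_mul_of_nonneg_right h₂ hU0
  have hpos : (0 : ℝ) < r * Δ := by linarith
  rw [one_div_mul_eq_div, div_div, div_le_iff₀ (by positivity)]
  linarith

end LocalInstance

/-! ### Choice of parameters and the number of rounds -/

lemma two_pow_clog_le {n : ℕ} (hn : 0 < n) : 2 ^ Nat.clog 2 n ≤ 2 * n := by
  rcases Nat.lt_or_ge 1 n with h | h
  · have h₁ := Nat.pow_pred_clog_lt_self one_lt_two h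
    have h₂ := Nat.clog_pos one_lt_two h
    have h₃ : 2 ^ Nat.clog 2 n = 2 * 2 ^ (Nat.clog 2 n).pred := by
      rw [← pow_succ', ← Nat.succ_eq_add_one, Nat.succ_pred_eq_of_pos h₂]
    omega
  · rw [Nat.clog_of_right_le_one h]
    omega

/-- Bertrand's postulate supplies both primes. Messages of length `d * K` suffice for the first code
since a prime is at least `2`; this makes `q₁` polynomial in `K`, so that messages of length
logarithmic in `K` suffice for the second. -/
lemma exists_splitParams {d K N : ℕ} (hK : 0 < K) (hN : N ≤ 2 ^ (d * K)) :
    ∃ p : SplitParams N, 32 * K ≤ p.B ^ 2 ∧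
      p.rounds ≤ 10000 * K *
        (2 * (Nat.clog 2 (514 * (d + 1)) + 2) * (Nat.clog 2 K + 1)) ^ 2 := by
  set B := Nat.sqrt (32 * K) + 1 with hB
  have hB₁ : 32 * K ≤ B ^ 2 := by rw [sq]; exact (Nat.lt_succ_sqrt _).le
  have hB₂ : B ^ 2 ≤ 128 * K := by
    have h₁ : 0 < Nat.sqrt (32 * K) := Nat.sqrt_pos.2 (by omega)
    have h₂ := Nat.sqrt_le' (32 * K)
    nlinarith
  have hB₃ : B ≤ 128 * K := (Nat.le_self_pow two_ne_zero B).trans hB₂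
  obtain ⟨q₁, hq₁, hlt₁, hle₁⟩ := Nat.exists_prime_lt_and_le_two_mul (2 * B * (d * K) + 1)
    (Nat.succ_ne_zero _)
  set a := Nat.clog 2 (514 * (d + 1)) with ha
  set l := Nat.clog 2 K with hl
  -- Chosen so that `q₁ ≤ 2 ^ (a + 2 * l)` gives `q₁ ^ 2 ≤ 2 ^ D ≤ q₂ ^ D`.
  set D := 2 * (a + 2 * l) with hD
  obtain ⟨q₂, hq₂, hlt₂, hle₂⟩ := Nat.exists_prime_lt_and_le_two_mul (2 * B * D + 1)
    (Nat.succ_ne_zero _)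
  have ha₁ : 514 * (d + 1) ≤ 2 ^ a := Nat.le_pow_clog one_lt_two _
  have hl₁ : K ≤ 2 ^ l := Nat.le_pow_clog one_lt_two _
  have ha₂ : 0 < a := Nat.clog_pos one_lt_two (by omega)
  have hq₁a : q₁ ≤ 2 ^ (a + 2 * l) := by
    calc q₁ ≤ 2 * (2 * B * (d * K) + 1) := hle₁
      _ ≤ 2 * (2 * (128 * K) * (d * K) + 1) := by gcongr
      _ ≤ 514 * (d + 1) * (K * K) := by nlinarith [Nat.mul_pos hK hK]
      _ ≤ 2 ^ a * (2 ^ l * 2 ^ l) := by gcongr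
      _ = 2 ^ (a + 2 * l) := by rw [pow_add, two_mul, pow_add]
  refine ⟨⟨B, q₁, q₂, d * K, D, Nat.succ_pos _, hq₁, hq₂,
    hN.trans (Nat.pow_le_pow_left hq₁.two_le _), ?_, by omega, by omega⟩, hB₁, ?_⟩
  · calc q₁ ^ 2 ≤ (2 ^ (a + 2 * l)) ^ 2 := Nat.pow_le_pow_left hq₁a 2
      _ = 2 ^ D := by rw [← pow_mul, hD, mul_comm]
      _ ≤ q₂ ^ D := Nat.pow_le_pow_left hq₂.two_le _
  · have hD₁ : 0 < D := by omega
    have hDle : D ≤ 2 * (a + 2) * (l + 1) := by rw [hD]; nlinarith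
    have hBD : 1 ≤ B * D := Nat.mul_pos (Nat.succ_pos _) hD₁
    have hq₂B : q₂ ≤ 6 * (B * D) := by linarith
    have hKD : 1 ≤ K * D ^ 2 := Nat.mul_pos hK (pow_pos hD₁ 2)
    have hKK : K ≤ K * D ^ 2 := Nat.le_mul_of_pos_right _ (pow_pos hD₁ 2)
    have hq₂sq : q₂ ^ 2 ≤ 4608 * (K * D ^ 2) := by
      calc q₂ ^ 2 ≤ (6 * (B * D)) ^ 2 := Nat.pow_le_pow_left hq₂B 2
        _ = 36 * (B ^ 2 * D ^ 2) := by ring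
        _ ≤ 36 * (128 * K * D ^ 2) := by gcongr
        _ = 4608 * (K * D ^ 2) := by ring
    calc 2 * (2 + q₂ ^ 2) + B ^ 2 ≤ 10000 * (K * D ^ 2) := by omega
      _ = 10000 * K * D ^ 2 := by ring
      _ ≤ _ := by gcongr

lemma clog_sq_le {r Δ : ℕ} (hr : 2 ≤ r) (hΔ : 2 ≤ Δ) :
    (Nat.clog 2 (4 * (r * Δ)) : ℝ) ^ 2
      ≤ 128 * (Real.log Δ ^ 2 + r * Real.log Δ) := by
  set K := Nat.clog 2 (4 * (r * Δ)) with hK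
  have hr0 : (0 : ℝ) < r := by positivity
  have hΔ0 : (0 : ℝ) < Δ := by positivity
  have hlog2 : (1 : ℝ) / 2 ≤ Real.log 2 := by linarith [Real.log_two_gt_d9]
  have hlogΔ : Real.log 2 ≤ Real.log Δ := Real.log_le_log two_pos (by exact_mod_cast hΔ)
  have hlogr : 0 ≤ Real.log r := Real.log_nonneg (by exact_mod_cast (show 1 ≤ r by omega))
  have hKlog : K * Real.log 2 ≤ 4 * Real.log Δ + Real.log r := by
    have h₁ : ((2 : ℝ) ^ K) ≤ 2 ^ 3 * (r * Δ) := by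
      have := two_pow_clog_le (n := 4 * (r * Δ)) (by positivity)
      have h' : 2 ^ K ≤ 2 ^ 3 * (r * Δ) := by rw [hK]; omega
      exact_mod_cast h'
    have h₂ := Real.log_le_log (by positivity) h₁
    rw [Real.log_pow, Real.log_mul (by positivity) (by positivity),
      Real.log_mul hr0.ne' hΔ0.ne', Real.log_pow] at h₂
    push_cast at h₂
    linarith
  -- From `log x ≤ x` at `x = √r`.
  have hsqrt : Real.log r ^ 2 ≤ 4 * r := by
    have h₁ := Real.log_le_self (Real.sqrt_nonneg (r : ℝ))
    rw [Real.log_sqrt hr0.le] at h₁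
    have h₂ := pow_le_pow_left₀ hlogr (show Real.log r ≤ 2 * √(r : ℝ) by linarith) 2
    rwa [mul_pow, Real.sq_sqrt hr0.le, show (2 : ℝ) ^ 2 = 4 by norm_num] at h₂
  have hK2 : (K : ℝ) / 2 ≤ 4 * Real.log Δ + Real.log r := by
    have := mul_le_mul_of_nonneg_left hlog2 (Nat.cast_nonneg (α := ℝ) K)
    linarith
  have hsq := pow_le_pow_left₀ (by positivity) hK2 2
  -- Here `Δ ≥ 2` is essential: `log Δ ≥ 1 / 2` lets `r * log Δ` absorb the square of `log r`.
  have hr2 : (r : ℝ) ≤ 2 * (r * Real.log Δ) := by nlinarith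
  nlinarith [sq_nonneg (4 * Real.log Δ - Real.log r)]

lemma clog_clog_le {K : ℕ} (hK : 0 < K) {x : ℝ} (hx : 0 ≤ x) (hKx : (K : ℝ) ^ 2 ≤ 128 * x) :
    ((Nat.clog 2 K : ℕ) : ℝ) + 1 ≤ 12 * Real.log (x + 2) := by
  have hK0 : (0 : ℝ) < K := by exact_mod_cast hK
  have hlog2 : (1 : ℝ) / 2 ≤ Real.log 2 := by linarith [Real.log_two_gt_d9]
  have h₁ : ((2 : ℝ) ^ (Nat.clog 2 K + 1)) ^ 2 ≤ 2 ^ 11 * (x + 2) := by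
    have h₂ : (2 : ℝ) ^ (Nat.clog 2 K + 1) ≤ 4 * K := by
      have := two_pow_clog_le hK
      have h' : 2 ^ (Nat.clog 2 K + 1) ≤ 4 * K := by rw [pow_succ]; omega
      exact_mod_cast h'
    have h₃ := pow_le_pow_left₀ (by positivity) h₂ 2
    linarith
  have h₂ := Real.log_le_log (by positivity) h₁
  rw [Real.log_pow, Real.log_pow, Real.log_mul (by positivity) (by positivity),
    Real.log_pow] at h₂
  have h₃ : Real.log 2 ≤ Real.log (x + 2) := Real.log_le_log two_pos (by linarith)
  push_cast at h₂
  have h₄ := mul_le_mul_of_nonneg_left hlog2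
    (show (0 : ℝ) ≤ (Nat.clog 2 K : ℝ) + 1 by positivity)
  linarith

/-- A constant for the number of rounds. -/
def roundsConst (d : ℕ) : ℕ :=
  20002 * (2 * (Nat.clog 2 (514 * (d + 1)) + 2)) ^ 2 * 128 * 144

lemma rounds_le {d r Δ R : ℕ} (hr : 2 ≤ r) (hΔ : 2 ≤ Δ)
    (hR : R ≤ 10000 * Nat.clog 2 (4 * (r * Δ)) * (2 * (Nat.clog 2 (514 * (d + 1)) + 2) *
      (Nat.clog 2 (Nat.clog 2 (4 * (r * Δ))) + 1)) ^ 2) :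
    ((2 * (Nat.clog 2 (4 * (r * Δ)) * R + 1) : ℕ) : ℝ) ≤ roundsConst d *
      ((Real.log Δ ^ 2 + r * Real.log Δ) * Real.log (Real.log Δ ^ 2 + r * Real.log Δ + 2) ^ 2) := by
  have hK2 := clog_sq_le hr hΔ
  have hKpos : 0 < Nat.clog 2 (4 * (r * Δ)) := Nat.clog_pos one_lt_two (by nlinarith)
  set K := Nat.clog 2 (4 * (r * Δ))
  set x := Real.log Δ ^ 2 + r * Real.log Δ with hx
  have hx0 : 0 ≤ x := by
    have : 0 ≤ Real.log Δ := Real.log_natCast_nonneg Δ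
    positivity
  have hl := clog_clog_le hKpos hx0 hK2
  set l := Nat.clog 2 K
  set b := 2 * (Nat.clog 2 (514 * (d + 1)) + 2) with hb
  have hb0 : 0 < b := Nat.mul_pos two_pos (Nat.succ_pos _)
  clear_value b l K
  have hnat : 2 * (K * R + 1) ≤ 20002 * b ^ 2 * (K ^ 2 * (l + 1) ^ 2) := by
    have h₁ : K * R ≤ K * (10000 * K * (b * (l + 1)) ^ 2) := Nat.mul_le_mul_left K hR
    have h₂ : 0 < b ^ 2 * (K ^ 2 * (l + 1) ^ 2) :=
      Nat.mul_pos (pow_pos hb0 2)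
        (Nat.mul_pos (pow_pos hKpos 2) (pow_pos (Nat.succ_pos _) 2))
    have h₃ : K * (10000 * K * (b * (l + 1)) ^ 2) = 10000 * (b ^ 2 * (K ^ 2 * (l + 1) ^ 2)) := by
      ring
    rw [mul_assoc]
    omega
  have hl2 : ((l : ℝ) + 1) ^ 2 ≤ 144 * Real.log (x + 2) ^ 2 := by
    have := pow_le_pow_left₀ (by positivity) hl 2
    rwa [mul_pow, show (12 : ℝ) ^ 2 = 144 by norm_num] at this
  calc ((2 * (K * R + 1) : ℕ) : ℝ) ≤ ((20002 * b ^ 2 * (K ^ 2 * (l + 1) ^ 2) : ℕ) : ℝ) :=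
        Nat.cast_le.2 hnat
    _ = 20002 * (b : ℝ) ^ 2 * ((K : ℝ) ^ 2 * ((l : ℝ) + 1) ^ 2) := by push_cast; ring
    _ ≤ 20002 * (b : ℝ) ^ 2 * (128 * x * (144 * Real.log (x + 2) ^ 2)) := by gcongr
    _ = _ := by
      rw [roundsConst, ← hb]
      push_cast
      ring

/-! ### Assembly -/

lemma MultiHypergraph.GoodColoring.ne {V : Type u} {E : Type v} {H : MultiHypergraph V E}
    {r Δ d : ℕ} (χ : H.GoodColoring r Δ d) {e f : E} {x : V} (he : x ∈ H.verts e)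
    (hf : x ∈ H.verts f) (hne : e ≠ f) : χ (Sum.inr e) ≠ χ (Sum.inr f) := by
  refine χ.valid ⟨fun h => hne (Sum.inr_injective h), ?_⟩
  have h₁ : H.incGraph.Adj (Sum.inr e) (Sum.inl x) := by
    simpa [MultiHypergraph.incGraph, SimpleGraph.fromRel_adj] using he
  have h₂ : H.incGraph.Adj (Sum.inl x) (Sum.inr f) := by
    simpa [MultiHypergraph.incGraph, SimpleGraph.fromRel_adj] using hf
  exact ⟨.cons h₁ (.cons h₂ .nil), le_rfl⟩

lemma MultiHypergraph.DegreeLE.isMatching {V : Type u} {E : Type v} {H : MultiHypergraph V E}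
    (h : H.DegreeLE 1) (M : Finset E) : H.IsMatching M := by
  intro e _ f _ hne
  rw [Function.onFun, Finset.disjoint_left]
  intro x he hf
  exact hne ((Set.ncard_le_one (h x).1).1 (h x).2 e he f hf)

lemma exists_matching_algorithm (d r Δ : ℕ) :
    ∃ (T : ℕ) (A : LocalAlgorithm (NodeInput ((r * Δ) ^ d)) Bool), 2 ≤ r → 1 ≤ Δ →
      (T : ℝ) ≤ roundsConst d * ((Real.log Δ ^ 2 + r * Real.log Δ) *
        Real.log (Real.log Δ ^ 2 + r * Real.log Δ + 2) ^ 2) ∧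
      ∀ (V : Type u) (E : Type v) [Finite V] [Fintype E] (H : MultiHypergraph V E),
        H.RankLE r → H.DegreeLE Δ →
        ∀ (ident : V ⊕ E ↪ ℕ) (χ : H.GoodColoring r Δ d) (a : E → ℝ≥0),
          H.IsMatching (H.selectedEdges A T ident a χ) ∧
          1 / 16 * ((∑ e, (a e : ℝ)) / ((r : ℝ) * (Δ : ℝ)))
            ≤ ∑ e ∈ H.selectedEdges A T ident a χ, (a e : ℝ) := by
  by_cases h : 2 ≤ r ∧ 2 ≤ Δ
  · obtain ⟨hr, hΔ⟩ := h
    have hK : 0 < Nat.clog 2 (4 * (r * Δ)) := Nat.clog_pos one_lt_two (by nlinarith)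
    have hK₁ : 4 * (r * Δ) ≤ 2 ^ Nat.clog 2 (4 * (r * Δ)) := Nat.le_pow_clog one_lt_two _
    have hK₂ := two_pow_clog_le (n := 4 * (r * Δ)) (by positivity)
    have hN : (r * Δ) ^ d ≤ 2 ^ (d * Nat.clog 2 (4 * (r * Δ))) := by
      rw [mul_comm d, pow_mul]
      exact Nat.pow_le_pow_left (by omega) d
    obtain ⟨p, hB, hR⟩ := exists_splitParams hK hN
    obtain ⟨φ, hφ, h⟩ := LocalInstance.exists_isLocal_heavy_matching.{u, v} p hK hB hK₁
      (by omega)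
    obtain ⟨A, hA⟩ := hφ.exists_algorithm
    refine ⟨_, A, fun _ _ => ⟨rounds_le hr hΔ hR, ?_⟩⟩
    intro V E _ _ H hrank hdeg ident χ a
    have hI := h ⟨V, E, inferInstance, H, ident, a, χ⟩
      (fun e f ⟨x, he, hf⟩ hne => χ.ne he hf hne) hrank hdeg
    rw [← hA] at hI
    exact hI
  -- For `Δ = 1` the bound on the rounds is `0`, so the algorithm must answer at once; it selects
  -- every hyperedge.
  · obtain ⟨A, hA⟩ := (LocalInstance.isLocal_const.{u, v} (k := (r * Δ) ^ d) (j := 0)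
      true).exists_algorithm
    refine ⟨2 * 0, A, fun hr hΔ => ?_⟩
    obtain rfl : Δ = 1 := by omega
    refine ⟨by simp, ?_⟩
    intro V E _ _ H hrank hdeg ident χ a
    refine ⟨hdeg.isMatching _, ?_⟩
    have hsel := hA ⟨V, E, inferInstance, H, ident, a, χ⟩
    change H.selectedEdges A (2 * 0) ident a χ = _ at hsel
    rw [hsel]
    have hS : 0 ≤ ∑ e, (a e : ℝ) := Finset.sum_nonneg fun e _ => (a e).2
    have hr' : (2 : ℝ) ≤ r := by exact_mod_cast hr
    simp only [Finset.filter_true]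
    rw [one_div_mul_eq_div, div_div]
    exact div_le_self hS (by push_cast; linarith)

theorem mainTheorem2 :
    ∃ c : ℝ, 0 < c ∧ ∀ d : ℕ,
      ∃ (T : ℕ → ℕ → ℕ) (A : ∀ r Δ : ℕ, LocalAlgorithm (NodeInput ((r * Δ) ^ d)) Bool),
        IsSoftO {p : ℕ × ℕ | 2 ≤ p.1 ∧ 1 ≤ p.2} (fun p => (T p.1 p.2 : ℝ))
          (fun p => Real.log (p.2 : ℝ) ^ 2 + (p.1 : ℝ) * Real.log (p.2 : ℝ)) ∧
        ∀ r Δ : ℕ, 2 ≤ r → 1 ≤ Δ →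
          ∀ (V : Type u) (E : Type v) [Finite V] [Fintype E] (H : MultiHypergraph V E),
            H.RankLE r → H.DegreeLE Δ →
            ∀ (ident : V ⊕ E ↪ ℕ) (χ : H.GoodColoring r Δ d) (a : E → ℝ≥0),
              H.IsMatching (H.selectedEdges (A r Δ) (T r Δ) ident a χ) ∧
              c * ((∑ e, (a e : ℝ)) / ((r : ℝ) * (Δ : ℝ))) ≤
                ∑ e ∈ H.selectedEdges (A r Δ) (T r Δ) ident a χ, (a e : ℝ) := by
  refine ⟨1 / 16, by norm_num, fun d => ?_⟩
  choose T A h using exists_matching_algorithm.{u, v} d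
  exact ⟨T, A, ⟨roundsConst d, 2, fun p hp => (h p.1 p.2 hp.1 hp.2).1⟩,
    fun r Δ hr hΔ => (h r Δ hr hΔ).2⟩
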